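/- Let $G=(V,E)$ be a finite simple undirected graph (not necessarily connected), and let $f,g\colon V\to\{1,2\}$ be two 2-colorings that are consistent, i.e. $|f^{-1}(i)|=|g^{-1}(i)|$ for $i=1,2$. A parallel swap on $G$ is a matching $S\subseteq E$; applying it to a coloring $f$ gives the coloring $fS$ with $fS(u)=f(v)$ if $\{u,v\}\in S$, and $fS(u)=f(u)$ if no edge of $S$ contains $u$. Let $\mathsf{rt}(G,f,g)$ be the least length $m$ of a sequence $\langle S_1,\dots,S_m\rangle$ of parallel swaps on $G$ with $(\cdots((fS_1)S_2)\cdots)S_m=g$ (and $\infty$ if there is no such sequence). **Theorem.** It is decidable in polynomial time whether $\mathsf{rt}(G,f,g)\le 2$ for consistent 2-colorings $f,g$ on a graph $G$. That is, there is a deterministic Turing machine that, given an instance $(G,f,g)$ with vertex set $\{0,\dots,n-1\}$, encoded by the adjacency matrix of $G$ and the values of $f$ and $g$ (a word of length $n(n+3)$ over a three-letter alphabet), halts after a number of steps bounded by a polynomial in the length of the input and outputs whether $\mathsf{rt}(G,f,g)\le 2$. -/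

import Mathlib

namespace ColoredRouting

/-- A parallel swap on `G`: a set of edges of `G` that is a matching. -/
structure ParallelSwap {V : Type*} (G : SimpleGraph V) where
  /-- the swaps that are performed simultaneously -/
  edges : Set (Sym2 V)
  subset_edgeSet : edges ⊆ G.edgeSet
  matching : ∀ u v₁ v₂ : V, s(u, v₁) ∈ edges → s(u, v₂) ∈ edges → v₁ = v₂

open Classical in
/-- The coloring `fS`: `fS(u) = f(v)` if `{u, v} ∈ S`, and `fS(u) = f(u)` if no edge of `S`
contains `u`. -/
noncomputable def applySwap {V : Type*} {G : SimpleGraph V} (f : V → ℕ) (S : ParallelSwap G) :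
    V → ℕ :=
  fun u => if h : ∃ v, s(u, v) ∈ S.edges then f h.choose else f u

theorem applySwap_of_mem {V : Type*} {G : SimpleGraph V} (f : V → ℕ) (S : ParallelSwap G)
    {u v : V} (h : s(u, v) ∈ S.edges) : applySwap f S u = f v := by
  have hex : ∃ v, s(u, v) ∈ S.edges := ⟨v, h⟩
  rw [applySwap, dif_pos hex, S.matching u _ v hex.choose_spec h]

theorem applySwap_of_not_mem {V : Type*} {G : SimpleGraph V} (f : V → ℕ) (S : ParallelSwap G)
    {u : V} (h : ∀ v, s(u, v) ∉ S.edges) : applySwap f S u = f u := by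
  rw [applySwap, dif_neg (by simpa using h)]

/-- The coloring obtained from `f` by performing a sequence of parallel swaps, first to last. -/
noncomputable def applySeq {V : Type*} {G : SimpleGraph V} (f : V → ℕ)
    (L : List (ParallelSwap G)) : V → ℕ :=
  L.foldl applySwap f

/-- `rt(G, f, g)`: the least length of a sequence of parallel swaps on `G` that turns `f` into `g`
(`⊤` if there is no such sequence). -/
noncomputable def rt {V : Type*} (G : SimpleGraph V) (f g : V → ℕ) : ℕ∞ :=
  ⨅ (L : List (ParallelSwap G)) (_ : applySeq f L = g), (L.length : ℕ∞)

/-- A `c`-coloring: a coloring with values in `{1, …, c}`. -/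
def IsColoring {V : Type*} (c : ℕ) (f : V → ℕ) : Prop :=
  ∀ v, 1 ≤ f v ∧ f v ≤ c

/-- Two colorings are consistent if every color is used equally often by both. -/
def Consistent {V : Type*} (f g : V → ℕ) : Prop :=
  ∀ i : ℕ, (f ⁻¹' {i}).encard = (g ⁻¹' {i}).encard

/-- An instance: a finite graph, with vertices named `0, …, n - 1`, and two consistent
2-colorings of its vertices. -/
structure TwoColorInstance where
  n : ℕ
  graph : SimpleGraph (Fin n)
  f : Fin n → ℕ
  g : Fin n → ℕ
  isColoring_f : IsColoring 2 f
  isColoring_g : IsColoring 2 g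
  consistent : Consistent f g

open Classical in
/-- The block of a vertex `u` in the encoding: one bit for `f(u)`, one bit for `g(u)`
(the bit is `true` for color 2), the row of `u` in the adjacency matrix, and an end marker. -/
noncomputable def TwoColorInstance.encodeVertex (I : TwoColorInstance) (u : Fin I.n) :
    List (Option Bool) :=
  some (decide (I.f u = 2)) :: some (decide (I.g u = 2)) ::
    ((List.finRange I.n).map (fun v => some (decide (I.graph.Adj u v))) ++ [none])

/-- The encoding of an instance (adjacency matrix and colors) as a word over the three-letter
alphabet `Option Bool`; its length is `n * (n + 3)`. -/
noncomputable def TwoColorInstance.encode (I : TwoColorInstance) : List (Option Bool) :=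
  (List.finRange I.n).flatMap I.encodeVertex

theorem TwoColorInstance.length_encodeVertex (I : TwoColorInstance) (u : Fin I.n) :
    (I.encodeVertex u).length = I.n + 3 := by
  simp [TwoColorInstance.encodeVertex]

theorem TwoColorInstance.length_encode (I : TwoColorInstance) :
    I.encode.length = I.n * (I.n + 3) := by
  simp [TwoColorInstance.encode, List.length_flatMap, I.length_encodeVertex]

theorem flatMap_inj_of_length {α β : Type*} (a b : α → List β)
    (hlen : ∀ x, (a x).length = (b x).length) :
    ∀ l : List α, l.flatMap a = l.flatMap b → ∀ x ∈ l, a x = b x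
  | [], _, x, hx => by simp at hx
  | y :: l, h, x, hx => by
      rw [List.flatMap_cons, List.flatMap_cons] at h
      obtain ⟨h1, h2⟩ := List.append_inj h (hlen y)
      rcases List.mem_cons.1 hx with rfl | hx
      · exact h1
      · exact flatMap_inj_of_length a b hlen l h2 x hx

theorem IsColoring.eq_of_decide {V : Type*} {f f' : V → ℕ} (hf : IsColoring 2 f)
    (hf' : IsColoring 2 f') (h : ∀ u, f u = 2 ↔ f' u = 2) : f = f' := by
  funext u
  have h1 := hf u
  have h2 := hf' u
  have h3 := h u
  omega

/-- Different instances have different encodings. -/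
theorem TwoColorInstance.encode_injective : Function.Injective TwoColorInstance.encode := by
  intro I J h
  have hn : I.n = J.n := by
    have hl := congrArg List.length h
    rw [I.length_encode, J.length_encode] at hl
    rcases lt_trichotomy I.n J.n with hlt | heq | hlt
    · nlinarith
    · exact heq
    · nlinarith
  obtain ⟨n, G, f, g, hf, hg, hc⟩ := I
  obtain ⟨n', G', f', g', hf', hg', hc'⟩ := J
  simp only at hn
  subst hn
  have hrow := flatMap_inj_of_length _ _
    (fun u => by rw [TwoColorInstance.length_encodeVertex, TwoColorInstance.length_encodeVertex])
    _ h
  simp only [TwoColorInstance.encodeVertex, List.mem_finRange, forall_const, List.cons.injEq,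
    Option.some.injEq, decide_eq_decide, List.append_cancel_right_eq, List.map_inj_left] at hrow
  have e1 : f = f' := hf.eq_of_decide hf' fun u => (hrow u).1
  have e2 : g = g' := hg.eq_of_decide hg' fun u => (hrow u).2.1
  have e3 : G = G' := by
    ext u v
    exact (hrow u).2.2 v
  subst e1 e2 e3
  rfl

open Classical in
/-- The property `P` of the objects of type `α`, presented to the machine as words by `enc`, is
decidable in polynomial time: a single (multi-stack) Turing machine with finitely many states
halts on every word `enc a` after a number of steps that is bounded by a polynomial in the length
of `enc a`, with output the one-bit word that tells whether `P a` holds. -/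
def PolyTimeDecidable {α Γ : Type} (enc : α → List Γ) (P : α → Prop) : Prop :=
  Nonempty (Turing.TM2ComputableInPolyTime enc Computability.encodeBool (fun a => decide (P a)))

end ColoredRouting

/-! Call `(f v, g v)` the type of a vertex `v`. Suppose two swaps turn `f` into `g`. Orient an edge
of the first swap from `f`-color 1 to `f`-color 2, and an edge of the second from `g`-color 2 to
`g`-color 1; edges between equal colors move nothing. The arcs form paths from type (1,2) to type
(2,1), with interior vertices of types (1,1) and (2,2) in alternation, and alternating cycles of
these two types; color 2 travels against the arcs. By consistency the types (1,2) and (2,1) are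
equally frequent, so artificial arcs from (2,1) to (1,2) close the paths; fixing the other vertices
gives a permutation (`exists_isRouting`). Conversely, the alternation lets the arcs of such a
permutation be split into two matchings, which serve as the two swaps (`IsRouting.exists_swaps`).

Whether `v` may be sent to `w` depends only on the two types, adjacency and equality. Hence the
question is whether a bipartite graph, with a row and a column for each vertex, has a perfect
matching (`TwoColorInstance.hasMatching_iff`).

This is decided by an auction. An unassigned row takes a cheapest admissible column, evicting its
owner if there is one, and the price rises by one; so an owned column is at most one dearer than any
column its owner could have. If all columns admissible for the bidder cost at least `n`, then some
`k` in `1, …, n` is not a price, and the columns dearer than `k`, all of them owned, include every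
column admissible for their owners or for the bidder: Hall's condition fails
(`Inv.not_hasMatching`). Prices stay at most `n`, so polynomially many steps suffice
(`Inv.decides`).

On the tape, prices, threshold and current column are unary counters with one digit per row. A sweep
treats one column; rotating the rows by one cell brings up the next one. Finite memory is enough for
this, and two stacks simulate the sweeping head. -/

namespace ColoredRouting

/-! ### Sweep machines -/

/-- Run a letter-to-letter transducer over a word; returns the final state and the output word. -/
def transduce {S D E : Type*} (δ : S → D → S × E) : S → List D → S × List E
  | s, [] => (s, [])
  | s, d :: w => ((transduce δ (δ s d).1 w).1, (δ s d).2 :: (transduce δ (δ s d).1 w).2)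

theorem transduce_append {S D E : Type*} (δ : S → D → S × E) (s : S) (u v : List D) :
    transduce δ s (u ++ v) = ((transduce δ (transduce δ s u).1 v).1,
      (transduce δ s u).2 ++ (transduce δ (transduce δ s u).1 v).2) := by
  induction u generalizing s with
  | nil => rfl
  | cons d u ih => simp [transduce, ih]

theorem length_transduce {S D E : Type*} (δ : S → D → S × E) (s : S) (u : List D) :
    (transduce δ s u).2.length = u.length := by
  induction u generalizing s with
  | nil => rfl
  | cons d u ih => simp [transduce, ih]

/-- A machine that sweeps over its tape from left to right and back again, rewriting the letters,
until it reaches a verdict at the left end. -/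
structure SweepMachine (S D : Type) where
  fwd : S → D → S × D
  turn : S → S
  bwd : S → D → S × D
  fin : S → S ⊕ Bool

namespace SweepMachine

variable {S D : Type} (M : SweepMachine S D)

/-- The result of one sweep from left to right and back. -/
def sweep (s : S) (w : List D) : (S ⊕ Bool) × List D :=
  let r := transduce M.fwd s w
  let q := transduce M.bwd (M.turn r.1) r.2.reverse
  (M.fin q.1, q.2.reverse)

theorem length_sweep (s : S) (w : List D) : (M.sweep s w).2.length = w.length := by
  simp [sweep, length_transduce]

/-- `M.Decides s w k b`: started on the word `w` in state `s`, the machine reaches the verdict `b`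
after `k` sweeps. -/
inductive Decides : S → List D → ℕ → Bool → Prop
  | verdict {s w b} (h : (M.sweep s w).1 = .inr b) : Decides s w 1 b
  | again {s w s' k b} (h : (M.sweep s w).1 = .inl s')
      (h' : Decides s' (M.sweep s w).2 k b) : Decides s w (k + 1) b

/-- The stacks of the Turing machine that simulates a sweep machine. -/
inductive Stack
  | inp | left | right | out
  deriving DecidableEq

instance : Fintype Stack := ⟨{.inp, .left, .right, .out}, fun k => by cases k <;> simp⟩

/-- The labels of the Turing machine that simulates a sweep machine. -/
inductive Label
  | load | unload | fwd | bwd | clear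
  deriving DecidableEq

instance : Fintype Label := ⟨{.load, .unload, .fwd, .bwd, .clear}, fun k => by cases k <;> simp⟩

/-- The stack alphabets. -/
@[reducible] def stackAlphabet (Γ D : Type) : Stack → Type
  | .inp => Γ
  | .left => D
  | .right => D
  | .out => Bool

variable {Γ : Type} (ini : Γ → D) (s₀ : S) (d₀ : D)

open Turing.TM2.Stmt in
/-- The program of the Turing machine that simulates a sweep machine. Its internal state consists
of the state of the sweep machine, a letter to be written, and the verdict. -/
def program : Label → Turing.TM2.Stmt (stackAlphabet Γ D) Label (S × Option D × Bool)
  | .load => pop .inp (fun v a => (v.1, a.map ini, v.2.2)) <|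
      branch (fun v => v.2.1.isSome)
        (push .left (fun v => v.2.1.getD d₀) <| goto fun _ => .load) (goto fun _ => .unload)
  | .unload => pop .left (fun v a => (v.1, a, v.2.2)) <|
      branch (fun v => v.2.1.isSome)
        (push .right (fun v => v.2.1.getD d₀) <| goto fun _ => .unload) (goto fun _ => .fwd)
  | .fwd => pop .right (fun v a => (a.elim v.1 fun d => (M.fwd v.1 d).1,
        a.map fun d => (M.fwd v.1 d).2, v.2.2)) <|
      branch (fun v => v.2.1.isSome)
        (push .left (fun v => v.2.1.getD d₀) <| goto fun _ => .fwd)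
        (load (fun v => (M.turn v.1, v.2)) <| goto fun _ => .bwd)
  | .bwd => pop .left (fun v a => (a.elim v.1 fun d => (M.bwd v.1 d).1,
        a.map fun d => (M.bwd v.1 d).2, v.2.2)) <|
      branch (fun v => v.2.1.isSome)
        (push .right (fun v => v.2.1.getD d₀) <| goto fun _ => .bwd)
        -- The optional letter has no letter to carry here, so it serves as a flag: `some` means
        -- that a verdict has been reached.
        (load (fun v => (M.fin v.1).elim (fun s => (s, none, v.2.2)) fun b => (s₀, some d₀, b)) <|
          branch (fun v => v.2.1.isSome) (goto fun _ => .clear) (goto fun _ => .fwd))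
  | .clear => pop .right (fun v a => (v.1, a, v.2.2)) <|
      branch (fun v => v.2.1.isSome) (goto fun _ => .clear) <|
        -- The halting configuration demanded by `Turing.haltList` has the initial internal state
        -- and no content besides the output, hence the clearing and the reset.
        push .out (fun v => v.2.2) <| load (fun _ => (s₀, none, false)) <| halt

/-- The Turing machine that simulates a sweep machine. -/
def toTM [Fintype S] [Fintype D] [Fintype Γ] : Turing.FinTM2 where
  K := Stack
  k₀ := .inp
  k₁ := .out
  Γ := stackAlphabet Γ D
  Λ := Label
  main := .load
  σ := S × Option D × Bool
  initialState := (s₀, none, false)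
  Γk₀Fin := inferInstanceAs (Fintype Γ)
  m := M.program ini s₀ d₀

/-- A configuration of the simulating machine. -/
def cfg (l : Option Label) (v : S × Option D × Bool) (a : List Γ) (x y : List D) (z : List Bool) :
    Turing.TM2.Cfg (stackAlphabet Γ D) Label (S × Option D × Bool) where
  l := l
  var := v
  stk := fun k => match k with
    | .inp => a
    | .left => x
    | .right => y
    | .out => z

/-- `M.Reach n c c'`: the simulating machine goes from `c` to `c'` in `n` steps. -/
def Reach (n : ℕ) (c c' : Turing.TM2.Cfg (stackAlphabet Γ D) Label (S × Option D × Bool)) : Prop :=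
  (flip bind (Turing.TM2.step (M.program ini s₀ d₀)))^[n] (some c) = some c'

/-! ### Step counts of the simulating Turing machine -/

section

variable {M ini s₀ d₀}

theorem Reach.trans {m n : ℕ}
    {c c' c'' : Turing.TM2.Cfg (stackAlphabet Γ D) Label (S × Option D × Bool)}
    (h : M.Reach ini s₀ d₀ m c c') (h' : M.Reach ini s₀ d₀ n c' c'') :
    M.Reach ini s₀ d₀ (n + m) c c'' := by
  unfold Reach at *
  rw [Function.iterate_add_apply, h, h']

theorem Reach.head {n : ℕ}
    {c c' c'' : Turing.TM2.Cfg (stackAlphabet Γ D) Label (S × Option D × Bool)}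
    (h : Turing.TM2.step (M.program ini s₀ d₀) c = some c')
    (h' : M.Reach ini s₀ d₀ n c' c'') : M.Reach ini s₀ d₀ (n + 1) c c'' :=
  Reach.trans (m := 1) (by simpa [Reach, flip] using h) h'

theorem Reach.single {c c' : Turing.TM2.Cfg (stackAlphabet Γ D) Label (S × Option D × Bool)}
    (h : Turing.TM2.step (M.program ini s₀ d₀) c = some c') : M.Reach ini s₀ d₀ 1 c c' := by
  simpa [Reach, flip] using h

theorem cfg_ext {l : Option Label} {v v' : S × Option D × Bool}
    {stk : ∀ k, List (stackAlphabet Γ D k)} {a : List Γ} {x y : List D} {z : List Bool}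
    (hv : v = v') (h₁ : stk .inp = a) (h₂ : stk .left = x) (h₃ : stk .right = y)
    (h₄ : stk .out = z) : (⟨l, v, stk⟩ : Turing.TM2.Cfg _ _ _) = cfg l v' a x y z := by
  subst hv h₁ h₂ h₃ h₄
  congr 1
  funext k
  cases k <;> rfl

variable (M ini s₀ d₀)

theorem reach_load (a : List Γ) (x : List D) (v : S × Option D × Bool) :
    M.Reach ini s₀ d₀ (a.length + 1) (cfg (some .load) v a x [] [])
      (cfg (some .unload) (v.1, none, v.2.2) [] ((a.map ini).reverse ++ x) [] []) := by
  induction a generalizing x v with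
  | nil =>
    apply Reach.single
    exact congrArg some (cfg_ext rfl rfl rfl rfl rfl)
  | cons d a ih =>
    have := ih (ini d :: x) (v.1, some (ini d), v.2.2)
    refine Reach.head ?_ (by simpa using this)
    exact congrArg some (cfg_ext rfl rfl rfl rfl rfl)

theorem reach_unload (x y : List D) (v : S × Option D × Bool) :
    M.Reach ini s₀ d₀ (x.length + 1) (cfg (some .unload) v [] x y [])
      (cfg (some .fwd) (v.1, none, v.2.2) [] [] (x.reverse ++ y) []) := by
  induction x generalizing y v with
  | nil =>
    apply Reach.single
    exact congrArg some (cfg_ext rfl rfl rfl rfl rfl)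
  | cons d a ih =>
    have := ih (d :: y) (v.1, some d, v.2.2)
    refine Reach.head ?_ (by simpa using this)
    exact congrArg some (cfg_ext rfl rfl rfl rfl rfl)

theorem reach_fwd (x y : List D) (s : S) (o : Option D) (b : Bool) :
    M.Reach ini s₀ d₀ (y.length + 1) (cfg (some .fwd) (s, o, b) [] x y [])
      (cfg (some .bwd) (M.turn (transduce M.fwd s y).1, none, b) []
        ((transduce M.fwd s y).2.reverse ++ x) [] []) := by
  induction y generalizing x s o with
  | nil =>
    apply Reach.single
    exact congrArg some (cfg_ext rfl rfl rfl rfl rfl)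
  | cons d a ih =>
    have := ih ((M.fwd s d).2 :: x) (M.fwd s d).1 (some (M.fwd s d).2)
    refine Reach.head ?_ (by simpa [transduce] using this)
    exact congrArg some (cfg_ext rfl rfl rfl rfl rfl)

/-- This stops just before the pop from the empty stack, because that last step depends on whether
`M.fin` gives a verdict. The leftover letter is irrelevant. -/
theorem reach_bwd (x y : List D) (s : S) (o : Option D) (b : Bool) :
    ∃ o', M.Reach ini s₀ d₀ x.length (cfg (some .bwd) (s, o, b) [] x y [])
      (cfg (some .bwd) ((transduce M.bwd s x).1, o', b) [] []
        ((transduce M.bwd s x).2.reverse ++ y) []) := by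
  induction x generalizing y s o with
  | nil => exact ⟨o, rfl⟩
  | cons d a ih =>
    obtain ⟨o', h⟩ := ih ((M.bwd s d).2 :: y) (M.bwd s d).1 (some (M.bwd s d).2)
    refine ⟨o', Reach.head ?_ (by simpa [transduce] using h)⟩
    exact congrArg some (cfg_ext rfl rfl rfl rfl rfl)

theorem reach_clear (y : List D) (s : S) (o : Option D) (b : Bool) :
    M.Reach ini s₀ d₀ (y.length + 1) (cfg (some .clear) (s, o, b) [] [] y [])
      (cfg none (s₀, none, false) [] [] [] [b]) := by
  induction y generalizing o with
  | nil =>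
    apply Reach.single
    exact congrArg some (cfg_ext rfl rfl rfl rfl rfl)
  | cons d a ih =>
    refine Reach.head ?_ (by simpa [transduce] using ih (some d))
    exact congrArg some (cfg_ext rfl rfl rfl rfl rfl)

theorem reach_sweep_again {s s' : S} {w : List D} (h : (M.sweep s w).1 = .inl s') (o : Option D)
    (b : Bool) :
    M.Reach ini s₀ d₀ (2 * w.length + 2) (cfg (some .fwd) (s, o, b) [] [] w [])
      (cfg (some .fwd) (s', none, b) [] [] (M.sweep s w).2 []) := by
  have h1 := reach_fwd M ini s₀ d₀ [] w s o b
  obtain ⟨o', h'⟩ := reach_bwd M ini s₀ d₀ _ [] _ _ b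
  have h2 := h1.trans h'
  refine cast ?_ (h2.trans (Reach.single (c' := cfg (some .fwd) (s', none, b) [] []
    (M.sweep s w).2 []) ?_))
  · congr 1
    simp [length_transduce]
    ring
  · simp only [sweep] at h
    simp [cfg, program, sweep, h]

theorem reach_sweep_verdict {s : S} {w : List D} {b' : Bool} (h : (M.sweep s w).1 = .inr b')
    (o : Option D) (b : Bool) :
    M.Reach ini s₀ d₀ (3 * w.length + 3) (cfg (some .fwd) (s, o, b) [] [] w [])
      (cfg none (s₀, none, false) [] [] [] [b']) := by
  have h1 := reach_fwd M ini s₀ d₀ [] w s o b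
  obtain ⟨o', h'⟩ := reach_bwd M ini s₀ d₀ _ [] _ _ b
  have h2 := h1.trans h'
  refine cast ?_ ((h2.trans (Reach.single (c' := cfg (some .clear) (s₀, some d₀, b') [] []
    (M.sweep s w).2 []) ?_)).trans (reach_clear M ini s₀ d₀ _ _ _ _))
  · congr 1
    simp [length_transduce, length_sweep]
    ring
  · simp only [sweep] at h
    simp [cfg, program, sweep, h]

/-- Sweeps preserve the length of the word, so each of them, even the last with its clearing phase,
costs at most `3 * w.length + 3` steps. -/
theorem Decides.reach {s : S} {w : List D} {k : ℕ} {b' : Bool} (h : M.Decides s w k b')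
    (o : Option D) (b : Bool) :
    ∃ t ≤ k * (3 * w.length + 3), M.Reach ini s₀ d₀ t (cfg (some .fwd) (s, o, b) [] [] w [])
      (cfg none (s₀, none, false) [] [] [] [b']) := by
  induction h generalizing o b with
  | verdict h => exact ⟨_, by simp, reach_sweep_verdict M ini s₀ d₀ h o b⟩
  | again h _ ih =>
    obtain ⟨t, ht, hr⟩ := ih none b
    refine ⟨_, ?_, (reach_sweep_again M ini s₀ d₀ h o b).trans hr⟩
    rw [length_sweep] at ht
    linarith

end

open Classical in
/-- A property that is decided by a sweep machine after polynomially many sweeps is decidable in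
polynomial time. -/
theorem polyTimeDecidable [Finite S] [Finite D] [Finite Γ] [Nonempty D] {α : Type}
    (enc : α → List Γ) (P : α → Prop) (p : Polynomial ℕ)
    (h : ∀ a, ∃ k ≤ p.eval (enc a).length,
      M.Decides s₀ ((enc a).map ini) k (decide (P a))) : PolyTimeDecidable enc P := by
  have := Fintype.ofFinite S
  have := Fintype.ofFinite D
  have := Fintype.ofFinite Γ
  obtain ⟨d₀⟩ := ‹Nonempty D›
  refine ⟨{ tm := M.toTM ini s₀ d₀
            inputAlphabet := Equiv.refl Γ
            outputAlphabet := Equiv.refl Bool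
            time := p * (3 * .X + 3) + 2 * .X + 2
            outputsFun := fun a => ?_ }⟩
  have key : ∃ t ≤ (p * (3 * .X + 3) + 2 * .X + 2 : Polynomial ℕ).eval (enc a).length,
      M.Reach ini s₀ d₀ t (cfg (some .load) (s₀, none, false) (enc a) [] [] [])
        (cfg none (s₀, none, false) [] [] [] [decide (P a)]) := by
    obtain ⟨k, hk, hd⟩ := h a
    obtain ⟨t, ht, hr⟩ := hd.reach M ini s₀ d₀ none false
    have h1 := (reach_load M ini s₀ d₀ (enc a) [] (s₀, none, false)).trans
      (reach_unload M ini s₀ d₀ _ [] _)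
    simp only [List.append_nil, List.reverse_reverse, List.length_reverse, List.length_map] at h1 ht
    refine ⟨_, ?_, h1.trans hr⟩
    have := Nat.mul_le_mul_right (3 * (enc a).length + 3) hk
    simp
    linarith
  choose t ht hr using key
  refine ⟨⟨t, ?_⟩, ht⟩
  have e1 : Turing.initList (M.toTM ini s₀ d₀) ((enc a).map (Equiv.refl Γ).invFun)
      = cfg (some .load) (s₀, none, false) (enc a) [] [] [] := by
    refine cfg_ext rfl ?_ rfl rfl rfl
    exact List.map_id _
  have e2 : Turing.haltList (M.toTM ini s₀ d₀)
      ((Computability.encodeBool (decide (P a))).map (Equiv.refl Bool).invFun)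
      = cfg none (s₀, none, false) [] [] [] [decide (P a)] :=
    cfg_ext rfl rfl rfl rfl rfl
  rw [e1, Option.map_some, e2]
  exact hr

end SweepMachine

/-! ### Row machines -/

/-- A machine working on a tape that is divided into rows. A row consists of two bits, a nonempty
list of cells and a header. In each sweep the machine visits the rows from first to last and back;
of each row it sees the two bits, the header and the first cell. On its way forward it may change
the header, on its way back the header and the cell. Finally every row is rotated by one cell. -/
structure RowMachine (F B H X : Type) where
  start : F
  fwd : F → Bool → Bool → H → X → F × H
  turn : F → B
  bwd : B → H → X → B × H × X
  fin : B → Option Bool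
  ofBit : Bool → X

/-- The letters on the tape of a row machine: bits, cells, and headers (with room for a cell). -/
abbrev Letter (H X : Type) := Bool ⊕ X ⊕ H × X

/-- The word that represents a row. -/
def rowWord {H X : Type} (f g : Bool) (xs : List X) (h : H) (y : X) : List (Letter H X) :=
  .inl f :: .inl g :: (xs.map (fun x => .inr (.inl x)) ++ [.inr (.inr (h, y))])

/-- The word that represents a row whose cells are given as bits. -/
def rawRowWord {H X : Type} (f g : Bool) (xs : List Bool) (h : H) (y : X) : List (Letter H X) :=
  .inl f :: .inl g :: (xs.map .inl ++ [.inr (.inr (h, y))])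

/-- The word that represents the first `n` rows. -/
def rowsWord {H X : Type} (f g : ℕ → Bool) (xs : ℕ → List X) (h : ℕ → H) (y : ℕ → X) (n : ℕ) :
    List (Letter H X) :=
  (List.range n).flatMap fun r => rowWord (f r) (g r) (xs r) (h r) (y r)

/-- The word that represents the first `n` rows, with cells given as bits. -/
def rawRowsWord {H X : Type} (f g : ℕ → Bool) (xs : ℕ → List Bool) (h : H) (y : X)
    (n : ℕ) : List (Letter H X) :=
  (List.range n).flatMap fun r => rawRowWord (f r) (g r) (xs r) h y

theorem rowsWord_succ {H X : Type} (f g : ℕ → Bool) (xs : ℕ → List X) (h : ℕ → H) (y : ℕ → X)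
    (n : ℕ) : rowsWord f g xs h y (n + 1) =
      rowsWord f g xs h y n ++ rowWord (f n) (g n) (xs n) (h n) (y n) := by
  simp [rowsWord, List.range_succ]

theorem rawRowsWord_succ {H X : Type} (f g : ℕ → Bool) (xs : ℕ → List Bool) (h : H)
    (y : X) (n : ℕ) : rawRowsWord f g xs h y (n + 1) =
      rawRowsWord f g xs h y n ++ rawRowWord (f n) (g n) (xs n) h y := by
  simp [rawRowsWord, List.range_succ]

/-! ### Simulation of row machines by sweep machines -/

namespace RowMachine

variable {F B H X : Type} (M : RowMachine F B H X)

/-- The states of the sweep machine that simulates a row machine: the state of the row machine and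
what has been read of the current row. -/
abbrev SweepState (F B X : Type) := (F ⊕ B) × Option Bool × Option Bool × Option X

/-- The forward transducer. -/
def sweepFwd : SweepState F B X → Letter H X → SweepState F B X × Letter H X
  | (s, none, _, _), .inl b => ((s, some b, none, none), .inl b)
  | (s, some f, none, _), .inl b => ((s, some f, some b, none), .inl b)
  | (s, some f, some g, none), .inl b =>
      ((s, some f, some g, some (M.ofBit b)), .inr (.inl (M.ofBit b)))
  | (s, some f, some g, none), .inr (.inl x) => ((s, some f, some g, some x), .inr (.inl x))
  | (s, some f, some g, some x), .inl b => ((s, some f, some g, some x), .inr (.inl (M.ofBit b)))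
  -- The first cell is copied next to the header at the end of the row, where the way back meets it
  -- before the other cells.
  | (.inl s, some f, some g, some x), .inr (.inr (h, _)) =>
      ((.inl (M.fwd s f g h x).1, none, none, none), .inr (.inr ((M.fwd s f g h x).2, x)))
  | s, l => (s, l)

/-- The backward transducer. -/
def sweepBwd : SweepState F B X → Letter H X → SweepState F B X × Letter H X
  | (.inr s, _, _, _), .inr (.inr (h, x)) =>
      ((.inr (M.bwd s h x).1, none, none, some (M.bwd s h x).2.2),
        .inr (.inr (M.bwd s h x).2))
  | (s, _, _, some x), .inr (.inl y) => ((s, none, none, some y), .inr (.inl x))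
  | (s, _, _, _), .inl b => ((s, none, none, none), .inl b)
  | s, l => (s, l)

/-- The sweep machine that simulates a row machine. -/
def toSweep : SweepMachine (SweepState F B X) (Letter H X) where
  fwd := M.sweepFwd
  turn s := (s.1.elim (fun s => .inr (M.turn s)) .inr, none, none, none)
  bwd := M.sweepBwd
  fin s := match s.1.elim (fun _ => none) M.fin with
    | none => .inl (.inl M.start, none, none, none)
    | some b => .inr b

theorem transduce_sweepFwd_cells (s : F) (f g : Bool) (x : X) (xs : List X) :
    transduce M.sweepFwd (.inl s, some f, some g, some x) (xs.map (fun x => .inr (.inl x))) =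
      ((.inl s, some f, some g, some x), xs.map (fun x => .inr (.inl x))) := by
  induction xs with
  | nil => rfl
  | cons y ys ih => simp [transduce, sweepFwd, ih]

theorem transduce_sweepFwd_bits (s : F) (f g : Bool) (x : X) (xs : List Bool) :
    transduce M.sweepFwd (.inl s, some f, some g, some x) (xs.map .inl) =
      ((.inl s, some f, some g, some x), xs.map (fun b => .inr (.inl (M.ofBit b)))) := by
  induction xs with
  | nil => rfl
  | cons y ys ih => simp [transduce, sweepFwd, ih]

theorem transduce_sweepFwd_rowWord (s : F) (f g : Bool) (x : X) (xs : List X) (h : H) (y : X) :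
    transduce M.sweepFwd (.inl s, none, none, none) (rowWord f g (x :: xs) h y) =
      ((.inl (M.fwd s f g h x).1, none, none, none),
        rowWord f g (x :: xs) (M.fwd s f g h x).2 x) := by
  simp [rowWord, transduce, sweepFwd, transduce_append, transduce_sweepFwd_cells]

theorem transduce_sweepFwd_rawRowWord (s : F) (f g : Bool) (x : Bool) (xs : List Bool) (h : H)
    (y : X) :
    transduce M.sweepFwd (.inl s, none, none, none) (rawRowWord f g (x :: xs) h y) =
      transduce M.sweepFwd (.inl s, none, none, none)
        (rowWord f g ((x :: xs).map M.ofBit) h y) := by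
  rw [List.map_cons, transduce_sweepFwd_rowWord]
  simp [rowWord, rawRowWord, transduce, sweepFwd, transduce_append, transduce_sweepFwd_bits]

/-- Every cell is replaced by the one carried from its right, which shifts the row to the left; the
old first cell drops out, its updated version having entered at the right end. -/
theorem transduce_sweepBwd_cells (s : B) (x : X) (xs : List X) :
    transduce M.sweepBwd (.inr s, none, none, some x)
      (xs.map (fun x => .inr (.inl x))).reverse =
      ((.inr s, none, none, (xs ++ [x]).head?),
        ((xs ++ [x]).tail.map (fun x => .inr (.inl x))).reverse) := by
  induction xs using List.reverseRecOn generalizing x with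
  | nil => rfl
  | append_singleton ys y ih =>
    have := ih y
    simp only [List.map_append, List.map_cons, List.map_nil, List.reverse_append,
      List.reverse_cons, List.reverse_nil, List.nil_append, List.singleton_append, transduce,
      sweepBwd, this]
    cases ys <;> simp

theorem transduce_sweepBwd_rowWord (s : B) (f g : Bool) (x z : X) (xs : List X) (h : H)
    (a b : Option Bool) (c : Option X) :
    transduce M.sweepBwd (.inr s, a, b, c) (rowWord f g (z :: xs) h x).reverse =
      ((.inr (M.bwd s h x).1, none, none, none),
        (rowWord f g (xs ++ [(M.bwd s h x).2.2]) (M.bwd s h x).2.1 (M.bwd s h x).2.2).reverse) := by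
  have := M.transduce_sweepBwd_cells (M.bwd s h x).1 (M.bwd s h x).2.2 (z :: xs)
  simp only [rowWord, List.reverse_cons, List.reverse_append, List.append_assoc, List.reverse_nil,
    List.nil_append, List.singleton_append, transduce, sweepBwd, transduce_append, this]
  simp

theorem transduce_sweepFwd_rowsWord {f g : ℕ → Bool} {x : ℕ → X} {xs : ℕ → List X} {h h' : ℕ → H}
    {y : ℕ → X} {n : ℕ} (s : ℕ → F)
    (hs : ∀ r < n, M.fwd (s r) (f r) (g r) (h r) (x r) = (s (r + 1), h' r)) :
    transduce M.sweepFwd (.inl (s 0), none, none, none)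
        (rowsWord f g (fun r => x r :: xs r) h y n) =
      ((.inl (s n), none, none, none), rowsWord f g (fun r => x r :: xs r) h' x n) := by
  induction n with
  | zero => rfl
  | succ n ih =>
    rw [rowsWord_succ, transduce_append, ih fun r hr => hs r (by omega),
      transduce_sweepFwd_rowWord, rowsWord_succ, hs n (by omega)]

/-- The forward pass turns raw bits into cells as it goes, so it leaves the same word whether or not
they were converted beforehand. The second part provides the state needed to append a row in the
induction. -/
theorem transduce_sweepFwd_rawRowsWord (f g : ℕ → Bool) (xs : ℕ → List Bool) (h : H)
    (y : X) (n : ℕ) (s : F) (hxs : ∀ r < n, xs r ≠ []) :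
    transduce M.sweepFwd (.inl s, none, none, none) (rawRowsWord f g xs h y n) =
      transduce M.sweepFwd (.inl s, none, none, none)
        (rowsWord f g (fun r => (xs r).map M.ofBit) (fun _ => h) (fun _ => y) n) ∧
    ∃ s', (transduce M.sweepFwd (.inl s, none, none, none)
        (rowsWord f g (fun r => (xs r).map M.ofBit) (fun _ => h) (fun _ => y) n)).1
          = (.inl s', none, none, none) := by
  induction n with
  | zero => exact ⟨rfl, s, rfl⟩
  | succ n ih =>
    obtain ⟨ih, s', hs'⟩ := ih fun r hr => hxs r (by omega)
    obtain ⟨z, zs, hz⟩ := List.exists_cons_of_ne_nil (hxs n (by omega))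
    rw [rawRowsWord_succ, transduce_append, rowsWord_succ, transduce_append, ih, hs', hz,
      transduce_sweepFwd_rawRowWord]
    refine ⟨rfl, ?_⟩
    rw [List.map_cons, transduce_sweepFwd_rowWord]
    exact ⟨_, rfl⟩

theorem transduce_sweepBwd_rowsWord {f g : ℕ → Bool} {x z x' : ℕ → X} {xs : ℕ → List X}
    {h h' : ℕ → H} {n : ℕ} (s : ℕ → B)
    (hs : ∀ r < n, M.bwd (s (r + 1)) (h r) (x r) = (s r, h' r, x' r)) :
    transduce M.sweepBwd (.inr (s n), none, none, none)
        (rowsWord f g (fun r => z r :: xs r) h x n).reverse =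
      ((.inr (s 0), none, none, none), (rowsWord f g (fun r => xs r ++ [x' r]) h' x' n).reverse) := by
  induction n with
  | zero => rfl
  | succ n ih =>
    rw [rowsWord_succ, List.reverse_append, transduce_append, transduce_sweepBwd_rowWord,
      hs n (by omega), ih fun r hr => hs r (by omega), rowsWord_succ, List.reverse_append]

/-- The initial state of the simulating sweep machine. -/
abbrev sweepStart : SweepState F B X := (.inl M.start, none, none, none)

/-- Reduces a sweep to local checks, one row at a time. The state before row `r` is `s r` on the way
forward and `s' (r + 1)` on the way back. -/
theorem sweep_rowsWord {f g : ℕ → Bool} {x x' : ℕ → X} {xs : ℕ → List X} {h h' h'' : ℕ → H}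
    {y : ℕ → X} {n : ℕ} (s : ℕ → F) (s' : ℕ → B) (h₀ : s 0 = M.start) (hn : M.turn (s n) = s' n)
    (hs : ∀ r < n, M.fwd (s r) (f r) (g r) (h r) (x r) = (s (r + 1), h' r))
    (hs' : ∀ r < n, M.bwd (s' (r + 1)) (h' r) (x r) = (s' r, h'' r, x' r)) :
    M.toSweep.sweep M.sweepStart (rowsWord f g (fun r => x r :: xs r) h y n) =
      (match M.fin (s' 0) with
        | none => .inl M.sweepStart
        | some b => .inr b, rowsWord f g (fun r => xs r ++ [x' r]) h'' x' n) := by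
  have h1 := M.transduce_sweepFwd_rowsWord (xs := xs) (y := y) s hs
  have h2 := M.transduce_sweepBwd_rowsWord (f := f) (g := g) (z := x) (xs := xs) s' hs'
  simp only [SweepMachine.sweep, toSweep, ← h₀, sweepStart]
  rw [h1]
  simp only [Sum.elim_inl, hn]
  rw [h2]
  simp

theorem sweep_rawRowsWord (f g : ℕ → Bool) (xs : ℕ → List Bool) (h : H) (y : X)
    (n : ℕ) (hxs : ∀ r < n, xs r ≠ []) :
    M.toSweep.sweep M.sweepStart (rawRowsWord f g xs h y n) =
      M.toSweep.sweep M.sweepStart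
        (rowsWord f g (fun r => (xs r).map M.ofBit) (fun _ => h) (fun _ => y) n) := by
  simp only [SweepMachine.sweep, toSweep]
  rw [(M.transduce_sweepFwd_rawRowsWord f g xs h y n M.start hxs).1]

end RowMachine

/-! ### The auction machine -/

/-- The types of a row vertex `u` and of a column vertex `w` (the pairs of bits for `f` and `g`),
adjacency and equality of `u` and `w` determine whether `w` is an admissible successor of `u`. -/
def admissible (a b : Bool × Bool) (adj eq : Bool) : Bool :=
  if a = (true, false) then b = (false, true) else
    b ≠ (false, true) ∧ (eq ∧ a.1 = a.2 ∨ adj ∧ ¬ (a.1 = a.2 ∧ b.1 = b.2 ∧ a.1 = b.1))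

/-- A header: whether the row is assigned to a column, and a digit of each of the unary
representations of the threshold and of the current column. -/
structure Header where
  assigned : Bool
  threshold : Bool
  past : Bool

/-- A cell: an entry of the adjacency matrix, whether the column is assigned to the row, and a digit
of the unary representation of the price of the column. -/
structure Cell where
  adj : Bool
  owned : Bool
  price : Bool

/-- The information that is collected on the way forward. -/
structure Scan where
  curType : Option (Bool × Bool)
  more : Bool
  bidder : Option ((Bool × Bool) × Bool × Bool)
  below : Bool
  full : Bool

/-- The decision that is carried out on the way back. -/
structure Decision where
  take : Bool
  wrap : Bool
  seek : Bool
  incPrice : Bool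
  incThreshold : Bool
  verdict : Option Bool

instance : Finite Header :=
  Finite.of_injective (fun h : Header => (h.assigned, h.threshold, h.past))
    (by rintro ⟨⟩ ⟨⟩; simp)

instance : Finite Cell :=
  Finite.of_injective (fun h : Cell => (h.adj, h.owned, h.price)) (by rintro ⟨⟩ ⟨⟩; simp)

instance : Finite Scan :=
  Finite.of_injective (fun s : Scan => (s.curType, s.more, s.bidder, s.below, s.full))
    (by rintro ⟨⟩ ⟨⟩; simp)

instance : Finite Decision :=
  Finite.of_injective
    (fun s : Decision => (s.take, s.wrap, s.seek, s.incPrice, s.incThreshold, s.verdict))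
    (by rintro ⟨⟩ ⟨⟩; simp)

/-- The auction machine. Row by row, it assigns columns to rows: the last unassigned row takes an
admissible column whose price is below the threshold, and the price increases. -/
def auction : RowMachine Scan Decision Header Cell where
  start := ⟨none, false, none, false, true⟩
  fwd s f g h x :=
    let cur := !h.past && s.curType.isNone
    (⟨if cur then some (f, g) else s.curType, s.more || s.curType.isSome,
      if h.assigned then s.bidder else some ((f, g), x.adj, cur),
      s.below || (h.threshold && !x.price), s.full && h.threshold⟩,
      { h with past := h.past || cur })
  turn s := match s.bidder with
    | none => ⟨false, false, false, false, false, some true⟩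
    | some (a, adj, eq) =>
      let take := admissible a (s.curType.getD (false, false)) adj eq && s.below
      ⟨take, !s.more, take, take, !take && !s.more,
        if !take && !s.more && s.full then some false else none⟩
  bwd d h x :=
    let win := d.seek && !h.assigned
    ({ d with seek := d.seek && h.assigned, incPrice := d.incPrice && x.price,
              incThreshold := d.incThreshold && h.threshold },
      ⟨if d.take then win || (h.assigned && !x.owned) else h.assigned,
        if d.take then false else h.threshold || d.incThreshold,
        if d.wrap then false else h.past⟩,
      ⟨x.adj, if d.take then win else x.owned, x.price || d.incPrice⟩)
  fin d := d.verdict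
  ofBit b := ⟨b, false, false⟩

/-- A state of the auction: the owners and the prices of the columns, the threshold, and the current
column. -/
structure AuctionState where
  owner : ℕ → Option ℕ
  price : ℕ → ℕ
  threshold : ℕ
  cur : ℕ

/-! ### States of the auction and their representation on the tape -/

namespace AuctionState

variable (n : ℕ) (f g : ℕ → Bool) (adj : ℕ → ℕ → Bool)

/-- A row is assigned if it owns a column. -/
def Assigned (A : AuctionState) (r : ℕ) : Prop := ∃ c < n, A.owner c = some r

open Classical in
/-- The last unassigned row among the first `k` rows. -/
noncomputable def bidder (A : AuctionState) : ℕ → Option ℕ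
  | 0 => none
  | k + 1 => if A.Assigned n k then A.bidder k else some k

open Classical in
/-- The header of a row. -/
noncomputable def header (A : AuctionState) (r : ℕ) : Header :=
  -- The threshold, like the prices, marks the last rows: the way back meets these first, and
  -- marking the first unmarked row adds one. The column counter marks the first rows, so the way
  -- forward recognizes row `A.cur` as the first unmarked one.
  ⟨decide (A.Assigned n r), decide (n ≤ r + A.threshold), decide (r < A.cur)⟩

/-- The cell of a row in a column. -/
def cell (A : AuctionState) (r c : ℕ) : Cell :=
  ⟨adj r c, decide (A.owner c = some r), decide (n ≤ r + A.price c)⟩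

/-- The columns, starting with column `v`. -/
def columns (v : ℕ) : List ℕ := List.range' v (n - v) ++ List.range v

/-- The tape that represents a state of the auction. -/
noncomputable def tape (A : AuctionState) (y : ℕ → Cell) : List (Letter Header Cell) :=
  rowsWord f g (fun r => (columns n A.cur).map (A.cell n adj r)) (A.header n) y n

/-- `c` is an admissible column for the row `r`. -/
def Adm (r c : ℕ) : Prop := admissible (f r, g r) (f c, g c) (adj r c) (decide (r = c)) = true

open Classical in
/-- The next state if row `i` takes the current column. -/
noncomputable def award (A : AuctionState) (i : ℕ) : AuctionState where
  owner := Function.update A.owner A.cur (some i)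
  price := Function.update A.price A.cur (A.price A.cur + 1)
  threshold := 0
  cur := if A.cur + 1 = n then 0 else A.cur + 1

/-- The next state if no row takes the current column. -/
def pass (A : AuctionState) : AuctionState where
  owner := A.owner
  price := A.price
  threshold := if A.cur + 1 = n then A.threshold + 1 else A.threshold
  cur := if A.cur + 1 = n then 0 else A.cur + 1

theorem bidder_eq_none {A : AuctionState} {k : ℕ} (h : A.bidder n k = none) :
    ∀ r < k, A.Assigned n r := by
  induction k with
  | zero => simp
  | succ k ih =>
    simp only [bidder] at h
    split_ifs at h with h1
    intro r hr
    rcases Nat.lt_succ_iff_lt_or_eq.1 hr with hr | rfl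
    · exact ih h r hr
    · exact h1

theorem bidder_eq_some {A : AuctionState} {k i : ℕ} (h : A.bidder n k = some i) :
    i < k ∧ ¬ A.Assigned n i ∧ ∀ r, i < r → r < k → A.Assigned n r := by
  induction k with
  | zero => simp [bidder] at h
  | succ k ih =>
    simp only [bidder] at h
    split_ifs at h with h1
    · obtain ⟨h2, h3, h4⟩ := ih h
      refine ⟨by omega, h3, fun r hr hr' => ?_⟩
      rcases Nat.lt_succ_iff_lt_or_eq.1 hr' with hr' | rfl
      · exact h4 r hr hr'
      · exact h1
    · obtain rfl : k = i := by simpa using h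
      exact ⟨by omega, h1, fun r _ _ => by omega⟩

/-- The columns after the first one. -/
def otherColumns (v : ℕ) : List ℕ := List.range' (v + 1) (n - (v + 1)) ++ List.range v

theorem columns_eq_cons {v : ℕ} (h : v < n) : columns n v = v :: otherColumns n v := by
  rw [columns, otherColumns, show n - v = n - (v + 1) + 1 by omega, List.range'_succ]
  rfl

theorem columns_next {v : ℕ} (h : v < n) :
    columns n (if v + 1 = n then 0 else v + 1) = otherColumns n v ++ [v] := by
  split_ifs with h1
  · subst h1
    simp [columns, otherColumns, ← List.range_eq_range', List.range_succ]
  · simp [columns, otherColumns, List.range_succ]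

theorem ne_of_mem_otherColumns {v c : ℕ} (h : c ∈ otherColumns n v) : c ≠ v := by
  simp only [otherColumns, List.mem_append, List.mem_range'_1, List.mem_range] at h
  omega

open Classical in
/-- What the auction machine knows after reading the first `k` rows. -/
noncomputable def scan (A : AuctionState) (k : ℕ) : Scan where
  curType := if A.cur < k then some (f A.cur, g A.cur) else none
  more := decide (A.cur + 1 < k)
  bidder := (A.bidder n k).map fun i => ((f i, g i), adj i A.cur, decide (i = A.cur))
  below := decide (∃ r < k, n ≤ r + A.threshold ∧ ¬ n ≤ r + A.price A.cur)
  full := decide (∀ r < k, n ≤ r + A.threshold)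

theorem scan_zero (A : AuctionState) : A.scan n f g adj 0 = auction.start := by
  simp [scan, auction, bidder]

theorem fwd_scan (A : AuctionState) (r : ℕ) :
    auction.fwd (A.scan n f g adj r) (f r) (g r) (A.header n r) (A.cell n adj r A.cur) =
      (A.scan n f g adj (r + 1), { A.header n r with past := decide (r < A.cur + 1) }) := by
  have hcur : (!decide (r < A.cur) && (if A.cur < r then some (f A.cur, g A.cur) else none).isNone)
      = decide (r = A.cur) := by
    rcases lt_trichotomy r A.cur with h | h | h
    · simp [h, h.ne]
    · simp [h]
    · simp [h, h.ne', h.not_gt]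
  simp only [auction, scan, header, cell, hcur]
  congr 1
  · congr 1
    · rcases lt_trichotomy r A.cur with h | h | h
      · simp [h.ne, show ¬ A.cur < r by omega, show ¬ A.cur < r + 1 by omega]
      · simp [h]
      · simp [h.ne', h, show A.cur < r + 1 by omega]
    · by_cases h : A.cur < r
      · simp [h]
      · simp [h]; omega
    · by_cases h : A.Assigned n r
      · simp [h, bidder]
      · by_cases h' : r = A.cur
        · simp [← h', h, bidder]
        · simp [h, bidder, h']
    · rw [Bool.eq_iff_iff, decide_eq_true_iff (p := ∃ r', r' < r + 1 ∧ _),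
        Nat.exists_lt_succ_right]
      simp
    · rw [Bool.eq_iff_iff, decide_eq_true_iff (p := ∀ r', r' < r + 1 → _),
        Nat.forall_lt_succ_right]
      simp
  · congr 1
    rw [Bool.eq_iff_iff]
    simp
    omega

/-- The decision of the auction machine on its way back, before the first `k` rows, if row `i` bids
and `take` tells whether it takes the current column. -/
def decision (A : AuctionState) (i : ℕ) (take : Bool) (k : ℕ) : Decision where
  take := take
  wrap := decide (A.cur + 1 = n)
  seek := take && decide (i < k)
  incPrice := take && decide (n ≤ k + A.price A.cur)
  incThreshold := !take && decide (A.cur + 1 = n) && decide (n ≤ k + A.threshold)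
  verdict := if take = false ∧ A.cur + 1 = n ∧ n ≤ A.threshold then some false else none

open Classical in
theorem turn_scan {A : AuctionState} {i : ℕ} (hi : A.bidder n n = some i) (hc : A.cur < n)
    (ht : A.threshold ≤ n) :
    auction.turn (A.scan n f g adj n) = A.decision n i
      (decide (Adm f g adj i A.cur ∧ A.price A.cur < A.threshold)) n := by
  have h1 : (∃ r < n, n ≤ r + A.threshold ∧ ¬ n ≤ r + A.price A.cur) ↔
      A.price A.cur < A.threshold :=
    -- Row `n - A.threshold` is the first one marked for the threshold; it is unmarked for any
    -- smaller price.
    ⟨fun ⟨r, _, h2, h3⟩ => by omega, fun h => ⟨n - A.threshold, by omega, by omega, by omega⟩⟩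
  have h2 : (∀ r < n, n ≤ r + A.threshold) ↔ n ≤ A.threshold :=
    ⟨fun h => by simpa using h 0 (by omega), fun h r _ => by omega⟩
  have h3 : (!decide (A.cur + 1 < n)) = decide (A.cur + 1 = n) := by
    rw [Bool.eq_iff_iff]
    simp
    omega
  have h4 : i < n := (bidder_eq_some n hi).1
  simp only [auction, scan, hi, Option.map_some, hc, if_true, Option.getD_some, h1, h2, h3,
    decision]
  have h5 : (admissible (f i, g i) (f A.cur, g A.cur) (adj i A.cur) (decide (i = A.cur)) &&
      decide (A.price A.cur < A.threshold)) =
      decide (Adm f g adj i A.cur ∧ A.price A.cur < A.threshold) := by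
    rw [Bool.eq_iff_iff, decide_eq_true_iff (p := Adm f g adj i A.cur ∧ _)]
    simp [Adm]
  rw [h5]
  generalize decide (Adm f g adj i A.cur ∧ A.price A.cur < A.threshold) = tk
  cases tk <;> simp [h4]

/-- Row `i` gains the current column and the previous owner, if any, loses it; as rows own at most
one column, that owner becomes unassigned. -/
theorem assigned_award {A : AuctionState} {i r : ℕ} (hc : A.cur < n)
    (hinj : ∀ c < n, ∀ c' < n, ∀ r, A.owner c = some r → A.owner c' = some r → c = c') :
    (A.award n i).Assigned n r ↔ r = i ∨ A.Assigned n r ∧ A.owner A.cur ≠ some r := by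
  constructor
  · rintro ⟨c, h1, h2⟩
    by_cases h : c = A.cur
    · left
      simpa [award, h, eq_comm] using h2
    · right
      simp only [award, ne_eq, h, not_false_eq_true, Function.update_of_ne] at h2
      exact ⟨⟨c, h1, h2⟩, fun h3 => h (hinj _ h1 _ hc _ h2 h3)⟩
  · rintro (rfl | ⟨⟨c, h1, h2⟩, h3⟩)
    · exact ⟨A.cur, hc, by simp [award]⟩
    · have h : c ≠ A.cur := by
        rintro rfl
        exact h3 h2
      exact ⟨c, h1, by simpa [award, h] using h2⟩

/-- The next state of the auction. -/
noncomputable def next (A : AuctionState) (i : ℕ) (take : Bool) : AuctionState :=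
  if take then A.award n i else A.pass n

theorem cur_next (A : AuctionState) (i : ℕ) (take : Bool) :
    (A.next n i take).cur = if A.cur + 1 = n then 0 else A.cur + 1 := by
  cases take <;> rfl

theorem bwd_decision {A : AuctionState} {i r : ℕ} (take : Bool) (hi : A.bidder n n = some i)
    (hc : A.cur < n) (hr : r < n)
    (hinj : ∀ c < n, ∀ c' < n, ∀ r, A.owner c = some r → A.owner c' = some r → c = c') :
    auction.bwd (A.decision n i take (r + 1))
        { A.header n r with past := decide (r < A.cur + 1) } (A.cell n adj r A.cur) =
      (A.decision n i take r, (A.next n i take).header n r,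
        (A.next n i take).cell n adj r A.cur) := by
  obtain ⟨_, h1, h2⟩ := bidder_eq_some n hi
  have hp : n ≤ r + A.price A.cur → n ≤ r + 1 + A.price A.cur := by omega
  cases take with
  | true =>
    -- The bidder is the last unassigned row, hence the first one met on the way back.
    have hwin : (i < r + 1 ∧ ¬ A.Assigned n r) ↔ r = i := by
      constructor
      · rintro ⟨h3, h4⟩
        by_contra h5
        exact h4 (h2 r (by omega) hr)
      · rintro rfl
        exact ⟨by omega, h1⟩
    have hseek : (i < r + 1 ∧ A.Assigned n r) ↔ i < r := by
      constructor
      · rintro ⟨h3, h4⟩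
        rcases Nat.lt_succ_iff_lt_or_eq.1 h3 with h5 | rfl
        · exact h5
        · exact absurd h4 h1
      · exact fun h3 => ⟨by omega, h2 r h3 hr⟩
    have hass := assigned_award n (i := i) (r := r) hc hinj
    refine Prod.ext ?_ (Prod.ext ?_ ?_)
    · simp only [auction, decision, header, cell, Decision.mk.injEq, true_and]
      refine ⟨?_, ?_, by simp, by simp⟩ <;> rw [Bool.eq_iff_iff]
      · simpa using hseek
      · simpa using hp
    · simp only [auction, decision, header, cell, Header.mk.injEq, if_true]
      refine ⟨?_, ?_, ?_⟩ <;> rw [Bool.eq_iff_iff]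
      · simp only [Bool.true_and, Bool.or_eq_true, Bool.and_eq_true, decide_eq_true_eq,
          Bool.not_eq_true', decide_eq_false_iff_not, hwin]
        exact hass.symm
      · simp [next, award, hr]
      · simp only [cur_next, decide_eq_true_eq]
        split_ifs <;> simp
    · simp only [auction, decision, header, cell, Cell.mk.injEq, true_and, if_true]
      refine ⟨?_, ?_⟩ <;> rw [Bool.eq_iff_iff]
      · simp only [Bool.true_and, Bool.and_eq_true, decide_eq_true_eq, Bool.not_eq_true',
          decide_eq_false_iff_not, hwin]
        simp [next, award, eq_comm]
      · simp only [next, award, if_true, Function.update_self, Bool.or_eq_true,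
          decide_eq_true_eq, Bool.true_and]
        omega
  | false =>
    refine Prod.ext ?_ (Prod.ext ?_ ?_)
    · simp only [auction, decision, header, cell, Decision.mk.injEq, true_and]
      refine ⟨by simp, by simp, ?_, by simp⟩
      rw [Bool.eq_iff_iff]
      have ht : n ≤ r + A.threshold → n ≤ r + 1 + A.threshold := by omega
      simp only [Bool.and_eq_true, decide_eq_true_eq]
      tauto
    · simp only [auction, decision, header, cell, Header.mk.injEq]
      refine ⟨?_, ?_, ?_⟩ <;> rw [Bool.eq_iff_iff]
      · simp only [decide_eq_true_eq, Bool.false_eq_true, if_false]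
        exact Iff.rfl
      · simp only [next, pass]
        (split_ifs <;> simp_all); omega
      · simp only [cur_next, decide_eq_true_eq]
        split_ifs <;> simp
    · simp [auction, decision, cell, next, pass]

theorem cell_next_of_ne {A : AuctionState} {i r c : ℕ} (take : Bool) (h : c ≠ A.cur) :
    (A.next n i take).cell n adj r c = A.cell n adj r c := by
  cases take <;> simp [next, cell, award, pass, h]

open Classical in
theorem sweep_tape {A : AuctionState} {i : ℕ} (hi : A.bidder n n = some i)
    (hc : A.cur < n) (ht : A.threshold ≤ n)
    (hinj : ∀ c < n, ∀ c' < n, ∀ r, A.owner c = some r → A.owner c' = some r → c = c')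
    (y : ℕ → Cell) (take : Bool)
    (htake : take = decide (Adm f g adj i A.cur ∧ A.price A.cur < A.threshold)) :
    ∃ y', auction.toSweep.sweep auction.sweepStart (A.tape n f g adj y) =
      (if take = false ∧ A.cur + 1 = n ∧ n ≤ A.threshold then .inr false
        else .inl auction.sweepStart, (A.next n i take).tape n f g adj y') := by
  have key := auction.sweep_rowsWord (f := f) (g := g) (x := fun r => A.cell n adj r A.cur)
    (x' := fun r => (A.next n i take).cell n adj r A.cur)
    (xs := fun r => (otherColumns n A.cur).map (A.cell n adj r))
    (h' := fun r => { A.header n r with past := decide (r < A.cur + 1) })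
    (h'' := (A.next n i take).header n) (y := y) (A.scan n f g adj) (A.decision n i take)
    (A.scan_zero n f g adj) (htake ▸ turn_scan n f g adj hi hc ht)
    (fun r _ => A.fwd_scan n f g adj r) (fun r hr => bwd_decision n adj take hi hc hr hinj)
  refine ⟨fun r => (A.next n i take).cell n adj r A.cur, ?_⟩
  rw [tape, columns_eq_cons n hc]
  simp only [List.map_cons]
  rw [key]
  refine Prod.ext ?_ ?_
  · simp only [auction, decision]
    split_ifs <;> rfl
  · simp only [tape, cur_next, columns_next n hc, List.map_append, List.map_cons, List.map_nil]
    congr 1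
    funext r
    congr 1
    refine List.map_congr_left fun c hc' => ?_
    rw [cell_next_of_ne n adj take (ne_of_mem_otherColumns n hc')]

theorem sweep_tape_accept {A : AuctionState} (hi : A.bidder n n = none) (hc : A.cur < n ∨ n = 0)
    (y : ℕ → Cell) :
    (auction.toSweep.sweep auction.sweepStart (A.tape n f g adj y)).1 = .inr true := by
  rcases hc with hc | rfl
  · let d : Decision := ⟨false, false, false, false, false, some true⟩
    have key := auction.sweep_rowsWord (f := f) (g := g) (x := fun r => A.cell n adj r A.cur)
      (x' := fun r => A.cell n adj r A.cur)
      (xs := fun r => (otherColumns n A.cur).map (A.cell n adj r))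
      (h' := fun r => { A.header n r with past := decide (r < A.cur + 1) })
      (h'' := fun r => { A.header n r with past := decide (r < A.cur + 1) }) (n := n)
      (y := y) (A.scan n f g adj) (fun _ => d)
      (A.scan_zero n f g adj) (by simp [auction, scan, hi, d])
      (fun r _ => A.fwd_scan n f g adj r) (fun r hr => by simp [auction, d])
    rw [tape, columns_eq_cons n hc]
    simp only [List.map_cons]
    rw [key]
    simp [auction, d]
  · rfl

end AuctionState

/-! ### Correctness and termination of the auction -/

namespace AuctionState

variable {n : ℕ} {f g : ℕ → Bool} {adj : ℕ → ℕ → Bool}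

variable (n f g adj) in
/-- The columns can be assigned to the rows in an admissible way. -/
def HasMatching : Prop :=
  ∃ σ : ℕ → ℕ, (∀ r < n, σ r < n ∧ Adm f g adj r (σ r)) ∧ ∀ r < n, ∀ r' < n, σ r = σ r' → r = r'

variable (n f g adj) in
/-- The invariant of the auction. -/
structure Inv (A : AuctionState) : Prop where
  cur_lt : A.cur < n
  threshold_le : A.threshold ≤ n
  owner_lt : ∀ c < n, ∀ r, A.owner c = some r → r < n
  owner_inj : ∀ c < n, ∀ c' < n, ∀ r, A.owner c = some r → A.owner c' = some r → c = c'
  adm : ∀ c < n, ∀ r, A.owner c = some r → Adm f g adj r c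
  price_le : ∀ c < n, A.price c ≤ n
  owned : ∀ c < n, 0 < A.price c → ∃ r, A.owner c = some r
  -- Approximate complementary slackness: owners hold a cheapest admissible column up to an error of
  -- one.
  tight : ∀ c < n, ∀ r, A.owner c = some r → ∀ c' < n, Adm f g adj r c' →
    A.price c ≤ A.price c' + 1
  -- Earlier rounds have excluded admissible prices below `A.threshold - 1`; the current round also
  -- excludes that value for the columns already passed.
  bid : ∀ i, A.bidder n n = some i → ∀ c < n, Adm f g adj i c →
    A.threshold ≤ A.price c + 1 ∧ (c < A.cur → A.threshold ≤ A.price c)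

/-- By `Inv.bid` the price paid is minimal among the columns admissible for the bidder, which gives
`tight` for the new owner. For the others it survives because prices only rise. A zero threshold
makes `bid` void, even in mid-round. -/
theorem Inv.award {A : AuctionState} (h : Inv n f g adj A) {i : ℕ} (hi : A.bidder n n = some i)
    (ha : Adm f g adj i A.cur) (hp : A.price A.cur < A.threshold) :
    Inv n f g adj (A.award n i) := by
  obtain ⟨hin, hfree, _⟩ := bidder_eq_some n hi
  have hown : ∀ {c r}, (A.award n i).owner c = some r →
      (c = A.cur ∧ r = i) ∨ (c ≠ A.cur ∧ A.owner c = some r) := by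
    intro c r hc
    by_cases hcc : c = A.cur
    · left
      simp only [AuctionState.award, hcc, Function.update_self, Option.some.injEq] at hc
      exact ⟨hcc, hc.symm⟩
    · right
      exact ⟨hcc, by simpa [AuctionState.award, hcc] using hc⟩
  have hpr : (A.award n i).price A.cur = A.price A.cur + 1 := by simp [AuctionState.award]
  have hpr' : ∀ {c}, c ≠ A.cur → (A.award n i).price c = A.price c := by
    intro c hc
    simp [AuctionState.award, hc]
  have hle : ∀ c, A.price c ≤ (A.award n i).price c := by
    intro c
    by_cases hc : c = A.cur
    · rw [hc, hpr]; omega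
    · rw [hpr' hc]
  have htl := h.threshold_le
  have hcl := h.cur_lt
  refine ⟨?_, Nat.zero_le _, ?_, ?_, ?_, ?_, ?_, ?_, ?_⟩
  · simp only [AuctionState.award]
    split_ifs <;> omega
  · intro c hc r hr
    rcases hown hr with ⟨rfl, rfl⟩ | ⟨_, hr⟩
    · exact hin
    · exact h.owner_lt c hc r hr
  · intro c hc c' hc' r hr hr'
    rcases hown hr with ⟨rfl, rfl⟩ | ⟨_, hr⟩ <;> rcases hown hr' with ⟨rfl, h1⟩ | ⟨_, hr'⟩
    · rfl
    · exact absurd ⟨c', hc', hr'⟩ hfree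
    · exact absurd ⟨c, hc, h1 ▸ hr⟩ hfree
    · exact h.owner_inj c hc c' hc' r hr hr'
  · intro c hc r hr
    rcases hown hr with ⟨rfl, rfl⟩ | ⟨_, hr⟩
    · exact ha
    · exact h.adm c hc r hr
  · intro c hc
    by_cases hcc : c = A.cur
    · rw [hcc, hpr]; omega
    · rw [hpr' hcc]; exact h.price_le c hc
  · intro c hc hpos
    by_cases hcc : c = A.cur
    · exact ⟨i, by simp [AuctionState.award, hcc]⟩
    · rw [hpr' hcc] at hpos
      obtain ⟨r, hr⟩ := h.owned c hc hpos
      exact ⟨r, by simpa [AuctionState.award, hcc] using hr⟩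
  · intro c hc r hr c' hc' hadm
    rcases hown hr with ⟨rfl, rfl⟩ | ⟨hcc, hr⟩
    · by_cases hcc' : c' = A.cur
      · subst hcc'; omega
      · rw [hpr, hpr' hcc']
        have := (h.bid _ hi c' hc' hadm).1
        omega
    · rw [hpr' hcc]
      have := h.tight c hc r hr c' hc' hadm
      have := hle c'
      omega
  · intro j _ c _ _
    exact ⟨Nat.zero_le _, fun _ => Nat.zero_le _⟩

theorem bidder_pass (A : AuctionState) (k : ℕ) : (A.pass n).bidder n k = A.bidder n k := by
  induction k with
  | zero => rfl
  | succ k ih =>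
    simp only [bidder, ih]
    rfl

theorem Inv.threshold_le_price {A : AuctionState} (h : Inv n f g adj A) {i : ℕ}
    (hi : A.bidder n n = some i) (ht : ¬ (Adm f g adj i A.cur ∧ A.price A.cur < A.threshold))
    {c : ℕ} (hc : c < n) (ha : Adm f g adj i c) (hcur : c < A.cur + 1) :
    A.threshold ≤ A.price c := by
  rcases Nat.lt_succ_iff_lt_or_eq.1 hcur with h1 | rfl
  · exact (h.bid i hi c hc ha).2 h1
  · by_contra h2
    exact ht ⟨ha, by omega⟩

theorem Inv.pass {A : AuctionState} (h : Inv n f g adj A) {i : ℕ} (hi : A.bidder n n = some i)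
    (ht : ¬ (Adm f g adj i A.cur ∧ A.price A.cur < A.threshold))
    (hf : ¬ (A.cur + 1 = n ∧ n ≤ A.threshold)) : Inv n f g adj (A.pass n) := by
  have htl := h.threshold_le
  have hcl := h.cur_lt
  refine ⟨?_, ?_, h.owner_lt, h.owner_inj, h.adm, h.price_le, h.owned, h.tight, ?_⟩
  · simp only [AuctionState.pass]
    split_ifs <;> omega
  · simp only [AuctionState.pass]
    split_ifs <;> omega
  · intro j hj c hc ha
    rw [bidder_pass, hi, Option.some.injEq] at hj
    subst hj
    have h1 := fun hcur => h.threshold_le_price hi ht hc ha hcur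
    have h2 := (h.bid i hi c hc ha).1
    simp only [AuctionState.pass]
    split_ifs with h3
    · exact ⟨by have := h1 (by omega); omega, by omega⟩
    · exact ⟨h2, h1⟩

theorem Inv.hasMatching {A : AuctionState} (h : Inv n f g adj A) (hi : A.bidder n n = none) :
    HasMatching n f g adj := by
  have key := bidder_eq_none n hi
  choose! σ h1 h2 using key
  refine ⟨σ, fun r hr => ⟨h1 r hr, h.adm _ (h1 r hr) _ (h2 r hr)⟩, fun r hr r' hr' hrr => ?_⟩
  have := h2 r hr
  rw [hrr, h2 r' hr'] at this
  simpa using this.symm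

/-- If every value `1, …, n` occurred, the `n` prices would all be positive, so every column would
be owned, by distinct rows, and no row would be left to bid. -/
theorem Inv.exists_gap {A : AuctionState} (h : Inv n f g adj A) {i : ℕ}
    (hi : A.bidder n n = some i) : ∃ k, 1 ≤ k ∧ k ≤ n ∧ ∀ c < n, A.price c ≠ k := by
  by_contra! hcon
  obtain ⟨hin, hfree, _⟩ := bidder_eq_some n hi
  have h1 : Finset.Icc 1 n ⊆ (Finset.range n).image A.price := by
    intro k hk
    rw [Finset.mem_Icc] at hk
    obtain ⟨c, hc, rfl⟩ := hcon k hk.1 hk.2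
    exact Finset.mem_image_of_mem _ (Finset.mem_range.2 hc)
  have h2 := Finset.eq_of_subset_of_card_le h1
    (Finset.card_image_le.trans (by simp))
  have h3 : ∀ c < n, ∃ r, A.owner c = some r := by
    intro c hc
    refine h.owned c hc ?_
    have := Finset.mem_image_of_mem A.price (Finset.mem_range.2 hc)
    rw [← h2, Finset.mem_Icc] at this
    exact this.1
  choose! φ hφ using h3
  have h4 : (Finset.range n).image φ = Finset.range n := by
    refine Finset.eq_of_subset_of_card_le ?_ ?_
    · intro r hr
      obtain ⟨c, hc, rfl⟩ := Finset.mem_image.1 hr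
      rw [Finset.mem_range] at hc ⊢
      exact h.owner_lt c hc _ (hφ c hc)
    · rw [Finset.card_image_of_injOn]
      intro c hc c' hc' hcc
      simp only [Finset.coe_range, Set.mem_Iio] at hc hc'
      exact h.owner_inj c hc c' hc' _ (hφ c hc) (hcc ▸ hφ c' hc')
  have h5 := Finset.mem_range.2 hin
  rw [← h4] at h5
  obtain ⟨c, hc, rfl⟩ := Finset.mem_image.1 h5
  rw [Finset.mem_range] at hc
  exact hfree ⟨c, hc, hφ c hc⟩

/-- With `k` from `Inv.exists_gap`, the columns dearer than `k` are owned. Their owners accept only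
prices at least `k`, by `tight`, and the bidder only prices at least `n`; as `k` is no price, these
columns are again dearer than `k`. So the set `S` would have to serve `S.card + 1` rows. -/
theorem Inv.not_hasMatching {A : AuctionState} (h : Inv n f g adj A) {i : ℕ}
    (hi : A.bidder n n = some i) (ht : ¬ (Adm f g adj i A.cur ∧ A.price A.cur < A.threshold))
    (hw : A.cur + 1 = n) (hf : n ≤ A.threshold) : ¬ HasMatching n f g adj := by
  rintro ⟨σ, hσ, hinj⟩
  obtain ⟨hin, hfree, _⟩ := bidder_eq_some n hi
  obtain ⟨k, hk1, hkn, hk⟩ := h.exists_gap hi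
  let S := (Finset.range n).filter fun c => k < A.price c
  have hS : ∀ {c}, c ∈ S ↔ c < n ∧ k < A.price c := by simp [S]
  have h3 : ∀ c ∈ S, ∃ r, A.owner c = some r := fun c hc =>
    h.owned c (hS.1 hc).1 (by have := (hS.1 hc).2; omega)
  choose! φ hφ using h3
  have hφi : Set.InjOn φ S := fun c hc c' hc' hcc =>
    h.owner_inj c (hS.1 hc).1 c' (hS.1 hc').1 _ (hφ c hc) (hcc ▸ hφ c' hc')
  have hnot : i ∉ S.image φ := by
    intro hmem
    obtain ⟨c, hc, rfl⟩ := Finset.mem_image.1 hmem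
    exact hfree ⟨c, (hS.1 hc).1, hφ c hc⟩
  have hlt : ∀ r ∈ insert i (S.image φ), r < n := by
    intro r hr
    rcases Finset.mem_insert.1 hr with rfl | hr
    · exact hin
    · obtain ⟨c, hc, rfl⟩ := Finset.mem_image.1 hr
      exact h.owner_lt c (hS.1 hc).1 _ (hφ c hc)
  have hcard : (insert i (S.image φ)).card ≤ S.card := by
    refine Finset.card_le_card_of_injOn σ ?_ fun r hr r' hr' => hinj r (hlt r hr) r' (hlt r' hr')
    intro r hr
    obtain ⟨h4, h5⟩ := hσ r (hlt r hr)
    have h6 := hk (σ r) h4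
    refine hS.2 ⟨h4, ?_⟩
    rcases Finset.mem_insert.1 hr with rfl | hr
    · have := h.threshold_le_price hi ht h4 h5 (by omega)
      omega
    · obtain ⟨c, hc, rfl⟩ := Finset.mem_image.1 hr
      have := h.tight c (hS.1 hc).1 _ (hφ c hc) _ h4 h5
      have := (hS.1 hc).2
      omega
  rw [Finset.card_insert_of_notMem hnot, Finset.card_image_of_injOn hφi] at hcard
  omega

variable (n) in
/-- The potential function of the auction. -/
def potential (A : AuctionState) : ℕ :=
  -- An award resets the threshold and possibly the column, losing at most `n * n + (n - 1)`, which
  -- is less than the weight `(n + 1) * n` of one unit of price.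
  (∑ c ∈ Finset.range n, A.price c) * ((n + 1) * n) + A.threshold * n + A.cur

/-- A bound for the potential. -/
def potentialBound (n : ℕ) : ℕ := n * n * ((n + 1) * n) + n * n + n

theorem Inv.potential_lt {A : AuctionState} (h : Inv n f g adj A) :
    A.potential n < potentialBound n := by
  have h1 : ∑ c ∈ Finset.range n, A.price c ≤ n * n := by
    simpa using Finset.sum_le_card_nsmul (Finset.range n) A.price n
      fun c hc => h.price_le c (Finset.mem_range.1 hc)
  have h2 := Nat.mul_le_mul_right ((n + 1) * n) h1
  have h3 := Nat.mul_le_mul_right n h.threshold_le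
  have h4 := h.cur_lt
  unfold potential potentialBound
  omega

theorem Inv.potential_award {A : AuctionState} (h : Inv n f g adj A) (i : ℕ) :
    A.potential n < (A.award n i).potential n := by
  have h1 : ∑ c ∈ Finset.range n, (A.award n i).price c =
      ∑ c ∈ Finset.range n, A.price c + 1 := by
    simp only [AuctionState.award]
    rw [Finset.sum_update_of_mem (Finset.mem_range.2 h.cur_lt),
      ← Finset.add_sum_erase _ _ (Finset.mem_range.2 h.cur_lt), Finset.erase_eq]
    ring
  have h3 := Nat.mul_le_mul_right n h.threshold_le
  have h4 := h.cur_lt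
  unfold potential
  have h5 : (n + 1) * n = n * n + n := by ring
  rw [h1, h5, add_mul _ 1]
  simp only [AuctionState.award]
  omega

theorem Inv.potential_pass {A : AuctionState} (h : Inv n f g adj A) :
    A.potential n < (A.pass n).potential n := by
  have h4 := h.cur_lt
  simp only [potential, AuctionState.pass]
  split_ifs
  · rw [add_mul A.threshold]
    omega
  · omega

open Classical in
theorem Inv.decides (m : ℕ) : ∀ (A : AuctionState) (y : ℕ → Cell), Inv n f g adj A →
    potentialBound n ≤ A.potential n + m →
    ∃ k ≤ m, auction.toSweep.Decides auction.sweepStart (A.tape n f g adj y) k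
      (decide (HasMatching n f g adj)) := by
  induction m with
  | zero =>
    intro A y h hm
    have := h.potential_lt
    omega
  | succ m ih =>
    intro A y h hm
    cases hi : A.bidder n n with
    | none =>
      refine ⟨1, by omega, .verdict ?_⟩
      rw [sweep_tape_accept n f g adj hi (.inl h.cur_lt), decide_eq_true (h.hasMatching hi)]
    | some i =>
      obtain ⟨take, htake⟩ : ∃ take, take =
        decide (Adm f g adj i A.cur ∧ A.price A.cur < A.threshold) := ⟨_, rfl⟩
      obtain ⟨y', hs⟩ := sweep_tape n f g adj hi h.cur_lt h.threshold_le h.owner_inj y take htake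
      by_cases hrej : take = false ∧ A.cur + 1 = n ∧ n ≤ A.threshold
      · have ht := of_decide_eq_false (htake.symm.trans hrej.1)
        refine ⟨1, by omega, .verdict ?_⟩
        rw [hs, if_pos hrej,
          decide_eq_false (h.not_hasMatching hi ht hrej.2.1 hrej.2.2)]
      · have hnext : Inv n f g adj (A.next n i take) ∧
            A.potential n < (A.next n i take).potential n := by
          cases take with
          | true =>
            have ht := of_decide_eq_true htake.symm
            exact ⟨h.award hi ht.1 ht.2, h.potential_award i⟩
          | false =>
            exact ⟨h.pass hi (of_decide_eq_false htake.symm) (by simpa using hrej),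
              h.potential_pass⟩
        obtain ⟨k, hk, hd⟩ := ih (A.next n i take) y' hnext.1 (by omega)
        refine ⟨k + 1, by omega, .again (s' := auction.sweepStart) (by rw [hs, if_neg hrej]) ?_⟩
        rwa [hs]

/-- The initial state of the auction. -/
def initial : AuctionState := ⟨fun _ => none, fun _ => 0, 0, 0⟩

theorem inv_initial (hn : 0 < n) : Inv n f g adj initial := by
  constructor <;> simp [initial, hn]

/-- The header at the beginning. -/
def initialHeader : Header := ⟨false, false, false⟩

theorem tape_initial (y : ℕ → Cell) : initial.tape n f g adj y =
    rowsWord f g (fun r => ((List.range n).map (adj r)).map auction.ofBit) (fun _ => initialHeader)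
      y n := by
  unfold tape rowsWord
  refine List.flatMap_congr fun r hr => ?_
  rw [List.mem_range] at hr
  have h1 : initial.header n r = initialHeader := by
    simp [header, initial, initialHeader, Assigned, hr]
  have h2 : (columns n initial.cur).map (initial.cell n adj r) =
      ((List.range n).map (adj r)).map auction.ofBit := by
    simp [columns, initial, ← List.range_eq_range', cell, auction, hr]
  simp only [h1, h2]

-- Only the first sweep sees the raw word, and its result is that for the initial tape. Without
-- vertices the empty tape is accepted at once.
open Classical in
theorem decides_rawRowsWord (y : Cell) :
    ∃ k ≤ potentialBound n + 1, auction.toSweep.Decides auction.sweepStart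
      (rawRowsWord f g (fun r => (List.range n).map (adj r)) initialHeader y n) k
      (decide (HasMatching n f g adj)) := by
  have hraw := auction.sweep_rawRowsWord f g (fun r => (List.range n).map (adj r))
    initialHeader y n (by
      intro r hr h
      simp only [List.map_eq_nil_iff, List.range_eq_nil] at h
      omega)
  rw [← tape_initial] at hraw
  rcases Nat.eq_zero_or_pos n with hn | hn
  · refine ⟨1, by omega, .verdict ?_⟩
    have h1 : HasMatching n f g adj := ⟨id, by omega, by omega⟩
    have h2 : initial.bidder n n = none := by rw [hn]; rfl
    rw [hraw, sweep_tape_accept n f g adj h2 (.inr hn), decide_eq_true h1]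
  · obtain ⟨k, hk, hd⟩ := Inv.decides (potentialBound n) initial (fun _ => y)
      (inv_initial (f := f) (g := g) (adj := adj) hn) (by omega)
    refine ⟨k, by omega, ?_⟩
    cases hd with
    | verdict h => exact .verdict (by rw [hraw]; exact h)
    | again h h' => exact .again (by rw [hraw]; exact h) (by rw [hraw]; exact h')

end AuctionState

/-! ### Two parallel swaps -/

/-- Shorter sequences are padded with the empty swap. -/
theorem rt_le_two_iff {V : Type*} {G : SimpleGraph V} {f g : V → ℕ} :
    rt G f g ≤ 2 ↔ ∃ S₁ S₂ : ParallelSwap G, applySwap (applySwap f S₁) S₂ = g := by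
  let E : ParallelSwap G := ⟨∅, Set.empty_subset _, fun _ _ _ h => h.elim⟩
  have hE : ∀ f : V → ℕ, applySwap f E = f := fun f => by
    funext u
    exact applySwap_of_not_mem f E fun v h => h.elim
  constructor
  · intro h
    have h3 : rt G f g < 3 := lt_of_le_of_lt h (by norm_num)
    simp only [rt, iInf_lt_iff] at h3
    obtain ⟨L, hL, h3⟩ := h3
    have h4 : L.length < 3 := by exact_mod_cast h3
    match L, hL, h4 with
    | [], hL, _ => exact ⟨E, E, by rw [hE, hE]; exact hL⟩
    | [S], hL, _ => exact ⟨S, E, by rw [hE]; exact hL⟩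
    | [S, T], hL, _ => exact ⟨S, T, hL⟩
  · rintro ⟨S, T, h⟩
    exact iInf₂_le [S, T] h

/-- The arcs of a permutation that start in `M` are pairwise disjoint edges, since no arc from `M`
ends in `M`. -/
theorem exists_swap {V : Type*} {G : SimpleGraph V} (σ : Equiv.Perm V) (M : Set V)
    (hadj : ∀ v ∈ M, G.Adj v (σ v)) (hM : ∀ v ∈ M, σ v ∉ M) (f : V → ℕ) :
    ∃ S : ParallelSwap G, (∀ v ∈ M, applySwap f S v = f (σ v)) ∧
      (∀ v, σ.symm v ∈ M → applySwap f S v = f (σ.symm v)) ∧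
      ∀ v, v ∉ M → σ.symm v ∉ M → applySwap f S v = f v := by
  have key : ∀ {u w}, (∃ v ∈ M, s(v, σ v) = s(u, w)) → (u ∈ M ∧ w = σ u) ∨ (w ∈ M ∧ u = σ w) := by
    rintro u w ⟨v, hv, h⟩
    rcases Sym2.eq_iff.1 h with ⟨rfl, rfl⟩ | ⟨rfl, rfl⟩
    · exact .inl ⟨hv, rfl⟩
    · exact .inr ⟨hv, rfl⟩
  let S : ParallelSwap G :=
    { edges := {e | ∃ v ∈ M, s(v, σ v) = e}
      subset_edgeSet := by
        rintro _ ⟨v, hv, rfl⟩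
        exact hadj v hv
      matching := by
        intro u v₁ v₂ h₁ h₂
        rcases key h₁ with ⟨h1, h2⟩ | ⟨h1, h2⟩ <;> rcases key h₂ with ⟨h3, h4⟩ | ⟨h3, h4⟩
        · rw [h2, h4]
        · exact absurd h1 (h4 ▸ hM _ h3)
        · exact absurd h3 (h2 ▸ hM _ h1)
        · exact σ.injective (h2.symm.trans h4) }
  refine ⟨S, fun v hv => applySwap_of_mem f S ⟨v, hv, rfl⟩, fun v hv =>
    applySwap_of_mem f S ⟨_, hv, ?_⟩, fun v h1 h2 => applySwap_of_not_mem f S fun w hw => ?_⟩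
  · rw [σ.apply_symm_apply, Sym2.eq_swap]
  · rcases key hw with ⟨h3, _⟩ | ⟨h3, rfl⟩
    · exact h1 h3
    · exact h2 (by simpa using h3)

/-- A permutation along which two parallel swaps move the colors: the vertices `v` with
`f v = 2` and `g v = 1` are mapped to those with `f v = 1` and `g v = 2`, any other vertex is mapped
to a neighbor or, if its colors agree, to itself. -/
def IsRouting {V : Type*} (G : SimpleGraph V) (f g : V → ℕ) (σ : V → V) : Prop :=
  ∀ v, (f v = 2 ∧ g v = 1 ∧ f (σ v) = 1 ∧ g (σ v) = 2) ∨
    (¬ (f v = 2 ∧ g v = 1) ∧ ¬ (f (σ v) = 1 ∧ g (σ v) = 2) ∧ (σ v = v ∧ f v = g v ∨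
      G.Adj v (σ v) ∧ ¬ (f v = g v ∧ f (σ v) = g (σ v) ∧ f v = f (σ v))))

theorem IsRouting.exists_swaps {V : Type*} {G : SimpleGraph V} {f g : V → ℕ}
    (hf : IsColoring 2 f) (hg : IsColoring 2 g) {σ : Equiv.Perm V} (h : IsRouting G f g σ) :
    ∃ S₁ S₂ : ParallelSwap G, applySwap (applySwap f S₁) S₂ = g := by
  -- The first swap takes the arcs whose `f`-colors go from 1 to 2, the second the remaining arcs
  -- whose `g`-colors go from 2 to 1. The artificial arcs fit neither pattern.
  obtain ⟨S₁, h1, h2, h3⟩ := exists_swap (G := G) σ {v | f v = 1 ∧ f (σ v) = 2}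
    (by
      rintro v ⟨hv, hv'⟩
      rcases h v with h1 | ⟨_, _, h1 | h1⟩
      · omega
      · rw [h1.1] at hv'; omega
      · exact h1.1)
    (by
      rintro v ⟨_, hv⟩ ⟨hv', _⟩
      omega) f
  obtain ⟨S₂, k1, k2, k3⟩ := exists_swap (G := G) σ
    {v | g v = 2 ∧ g (σ v) = 1 ∧ ¬ (f v = 1 ∧ f (σ v) = 2)}
    (by
      rintro v ⟨hv, hv', _⟩
      rcases h v with h1 | ⟨_, _, h1 | h1⟩
      · omega
      · rw [h1.1] at hv'; omega
      · exact h1.1)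
    (by
      rintro v ⟨_, hv, _⟩ ⟨hv', _⟩
      omega) (applySwap f S₁)
  refine ⟨S₁, S₂, ?_⟩
  funext u
  simp only [Set.mem_ofPred_eq, Equiv.apply_symm_apply] at h1 h2 h3 k1 k2 k3
  have r : ∀ v, σ v ≠ v → (f v = 2 ∧ g v = 1 ∧ f (σ v) = 1 ∧ g (σ v) = 2) ∨
      (¬ (f v = 2 ∧ g v = 1) ∧ ¬ (f (σ v) = 1 ∧ g (σ v) = 2) ∧
        ¬ (f v = g v ∧ f (σ v) = g (σ v) ∧ f v = f (σ v))) := by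
    intro v hv
    rcases h v with h1 | ⟨h1, h2, h3 | h3⟩
    · exact .inl h1
    · exact absurd h3.1 hv
    · exact .inr ⟨h1, h2, h3.2⟩
  have m₁ : ∀ v, f v = 1 → applySwap f S₁ v = f (σ v) := by
    intro v hv
    have := hf (σ v)
    by_cases h4 : f (σ v) = 2
    · exact h1 v ⟨hv, h4⟩
    · rw [h3 v (by omega) (by omega)]
      omega
  have m₂ : ∀ v, f (σ v) = 2 → applySwap f S₁ (σ v) = f v := by
    intro v hv
    have := hf v
    have h2 := h2 (σ v)
    have h3 := h3 (σ v)
    rw [σ.symm_apply_apply] at h2 h3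
    by_cases h4 : f v = 1
    · exact h2 ⟨h4, hv⟩
    · rw [h3 (by omega) (by omega)]
      omega
  -- A moving vertex of type (1,1) or (2,2) changes color in the first swap: a color 1 is exchanged
  -- along the outgoing arc, a color 2 along the incoming one.
  have m₃ : ∀ v, σ v ≠ v → f (σ v) = g (σ v) → applySwap f S₁ (σ v) + f (σ v) = 3 := by
    intro v hv hfg
    have r0 := r v hv
    have r1 := r (σ v) (by simpa using hv)
    have := hf v
    have := hg v
    have := hf (σ v)
    have := hf (σ (σ v))
    have := hg (σ (σ v))
    rcases (by omega : f (σ v) = 1 ∨ f (σ v) = 2) with h4 | h4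
    · rw [m₁ _ h4]
      omega
    · rw [m₂ _ h4]
      omega
  clear h1 h2 h3
  -- The intermediate color of the predecessor of `u` may depend on the arc entering that
  -- predecessor, so two steps back are needed.
  obtain ⟨w, rfl⟩ := σ.surjective u
  obtain ⟨z, rfl⟩ := σ.surjective w
  replace k2 := k2 (σ (σ z))
  replace k3 := k3 (σ (σ z))
  replace k1 := k1 (σ (σ z))
  simp only [Equiv.symm_apply_apply] at k2 k3
  have f1 := hf (σ z)
  have f2 := hf (σ (σ z))
  have f3 := hf (σ (σ (σ z)))
  have g1 := hg (σ z)
  have g2 := hg (σ (σ z))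
  have g3 := hg (σ (σ (σ z)))
  by_cases hfix : σ z = z
  · have hz := h z
    have m₁ := m₁ z
    have m₂ := m₂ z
    simp only [hfix] at *
    omega
  · have i1 := m₁ (σ z)
    have j1 := m₁ (σ (σ z))
    have j2 := m₂ (σ z)
    have l2 := m₂ (σ (σ z))
    have i3 := m₃ z hfix
    have j3 := m₃ (σ z) (by simpa using hfix)
    have l3 := m₃ (σ (σ z)) (by simpa using hfix)
    have r1 := r (σ z) (by simpa using hfix)
    have r2 := r (σ (σ z)) (by simpa using hfix)
    clear r h m₁ m₂ m₃ hfix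
    by_cases c1 : g (σ (σ z)) = 2 ∧ g (σ (σ (σ z))) = 1 ∧
        ¬ (f (σ (σ z)) = 1 ∧ f (σ (σ (σ z))) = 2)
    · rw [k1 c1]
      clear k1 k2 k3
      omega
    · by_cases c2 : g (σ z) = 2 ∧ g (σ (σ z)) = 1 ∧ ¬ (f (σ z) = 1 ∧ f (σ (σ z)) = 2)
      · rw [k2 c2]
        clear k1 k2 k3
        omega
      · rw [k3 c1 c2]
        clear k1 k2 k3 j3 l3 i1
        rcases (by omega : f (σ (σ z)) = 1 ∨ f (σ (σ z)) = 2) with ha | ha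
        · have j1 := j1 ha
          clear j2 l2 i3
          omega
        · have j2 := j2 ha
          clear j1 l2 i3
          omega

theorem exists_isRouting {V : Type*} [Finite V] {G : SimpleGraph V} {f g : V → ℕ}
    (hf : IsColoring 2 f) (hg : IsColoring 2 g) (hfg : Consistent f g) {S₁ S₂ : ParallelSwap G}
    (h : applySwap (applySwap f S₁) S₂ = g) : ∃ σ : Equiv.Perm V, IsRouting G f g σ := by
  classical
  have := Fintype.ofFinite V
  have swap_eq : ∀ (k : V → ℕ) (S : ParallelSwap G) {v w}, s(v, w) ∈ S.edges →
      applySwap k S v = k w ∧ applySwap k S w = k v := fun k S v w hvw =>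
    ⟨applySwap_of_mem k S hvw, applySwap_of_mem k S (Sym2.eq_swap ▸ hvw)⟩
  have swap_ne : ∀ (k : V → ℕ) (S : ParallelSwap G) {v}, applySwap k S v ≠ k v →
      ∃ w, s(v, w) ∈ S.edges := by
    intro k S v hv
    by_contra hcon
    push Not at hcon
    exact hv (applySwap_of_not_mem k S hcon)
  set m := applySwap f S₁ with hm
  have ex1 : ∀ v, m v ≠ f v → ∃ w, s(v, w) ∈ S₁.edges ∧ f w ≠ f v := by
    intro v hv
    obtain ⟨w, hw⟩ := swap_ne f S₁ hv
    exact ⟨w, hw, fun he => hv ((swap_eq f S₁ hw).1.trans he)⟩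
  have ex2 : ∀ v, m v ≠ g v → ∃ w, s(v, w) ∈ S₂.edges ∧ g w ≠ g v := by
    intro v hv
    obtain ⟨w, hw⟩ := swap_ne m S₂ (v := v) (by rw [h]; exact hv.symm)
    have := swap_eq m S₂ hw
    rw [h] at this
    exact ⟨w, hw, fun he => hv (this.2.symm.trans he)⟩
  have hmc : ∀ v, m v = 1 ∨ m v = 2 := by
    intro v
    have hv := hf v
    by_cases hmv : m v = f v
    · omega
    · obtain ⟨w, hw⟩ := swap_ne f S₁ hmv
      have : m v = f w := (swap_eq f S₁ hw).1
      have := hf w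
      omega
  let P₁ : V → V → Prop := fun v w => s(v, w) ∈ S₁.edges ∧ f v = 1 ∧ f w = 2
  let P₂ : V → V → Prop := fun v w => s(v, w) ∈ S₂.edges ∧ g v = 2 ∧ g w = 1
  let Q : V → V → Prop := fun v w => P₁ v w ∨ (¬ ∃ z, P₁ v z) ∧ P₂ v w ∨
    (¬ ∃ z, P₁ v z) ∧ (¬ ∃ z, P₂ v z) ∧ w = v
  have hQ : ∀ v, ∃ w, Q v w := by
    intro v
    by_cases h1 : ∃ z, P₁ v z
    · exact h1.imp fun z => .inl
    · by_cases h2 : ∃ z, P₂ v z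
      · exact h2.imp fun z hz => .inr (.inl ⟨h1, hz⟩)
      · exact ⟨v, .inr (.inr ⟨h1, h2, rfl⟩)⟩
  choose τ hτ using hQ
  have e1 : ∀ {v w}, P₁ v w → m v = 2 ∧ m w = 1 := by
    rintro v w ⟨h1, h2, h3⟩
    have : m v = f w ∧ m w = f v := swap_eq f S₁ h1
    omega
  have e2 : ∀ {v w}, P₂ v w → m v = 1 ∧ m w = 2 := by
    rintro v w ⟨h1, h2, h3⟩
    have := swap_eq m S₂ h1
    rw [h] at this
    omega
  have x1 : ∀ {v}, (¬ ∃ z, P₁ v z) → f v = 1 → m v = 1 := by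
    intro v hv hfv
    by_contra hne
    obtain ⟨w, h1, h2⟩ := ex1 v (by omega)
    have := hf w
    exact hv ⟨w, h1, hfv, by omega⟩
  have x2 : ∀ {v}, (¬ ∃ z, P₂ v z) → g v = 2 → m v = 2 := by
    intro v hv hgv
    by_contra hne
    obtain ⟨w, h1, h2⟩ := ex2 v (by omega)
    have := hg w
    exact hv ⟨w, h1, hgv, by omega⟩
  have hA : ∀ v, ¬ (f (τ v) = 1 ∧ g (τ v) = 2) := by
    rintro v ⟨h1, h2⟩
    rcases hτ v with h3 | ⟨_, h3⟩ | ⟨h3, h4, h5⟩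
    · have := h3.2.2; omega
    · have := h3.2.2; omega
    · rw [h5] at h1 h2
      have := x1 h3 h1
      have := x2 h4 h2
      omega
  -- The intermediate color at the head of an arc is 1 for the first swap and 2 for the second, so
  -- arcs of different kinds do not share a head. A head of type other than (2,1) has an outgoing
  -- arc as well, so it is not a fixed point.
  have hinj : ∀ v w, ¬ (f v = 2 ∧ g v = 1) → ¬ (f w = 2 ∧ g w = 1) → τ v = τ w → v = w := by
    have m12 : ∀ {v w z}, P₁ v z → P₂ w z → False := by
      intro v w z h1 h2
      have := e1 h1
      have := e2 h2
      omega
    have m13 : ∀ {v w}, ¬ (f w = 2 ∧ g w = 1) → P₁ v w → (¬ ∃ z, P₂ w z) → False := by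
      intro v w hw h1 h2
      have := e1 h1
      have := h1.2.2
      have := hg w
      have := x2 h2 (by omega)
      omega
    have m23 : ∀ {v w}, ¬ (f w = 2 ∧ g w = 1) → P₂ v w → (¬ ∃ z, P₁ w z) → False := by
      intro v w hw h1 h2
      have := e2 h1
      have := h1.2.2
      have := hf w
      have := x1 h2 (by omega)
      omega
    intro v w hv hw hvw
    have sv := hτ v
    have sw := hτ w
    rw [← hvw] at sw
    generalize τ v = z at *
    rcases sv with h1 | ⟨_, h1⟩ | ⟨h1, h2, rfl⟩ <;> rcases sw with k1 | ⟨_, k1⟩ | ⟨k1, k2, k3⟩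
    · exact S₁.matching z v w (Sym2.eq_swap ▸ h1.1) (Sym2.eq_swap ▸ k1.1)
    · exact (m12 h1 k1).elim
    · subst k3
      exact (m13 hw h1 k2).elim
    · exact (m12 k1 h1).elim
    · exact S₂.matching z v w (Sym2.eq_swap ▸ h1.1) (Sym2.eq_swap ▸ k1.1)
    · subst k3
      exact (m23 hw h1 k1).elim
    · exact (m13 hv k1 h2).elim
    · exact (m23 hv k1 h1).elim
    · exact k3
  -- Consistency gives equally many vertices with `f v = 2` and with `g v = 2`; removing those of
  -- type (2,2) leaves types (2,1) and (1,2).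
  have hcard : Fintype.card {v // ¬ (f v = 2 ∧ g v = 1)} =
      Fintype.card {v // ¬ (f v = 1 ∧ g v = 2)} := by
    have hc : (Finset.univ.filter fun v => f v = 2).card =
        (Finset.univ.filter fun v => g v = 2).card := by
      have h1 := hfg 2
      rw [← Set.coe_toFinset (f ⁻¹' {2}), ← Set.coe_toFinset (g ⁻¹' {2}),
        Set.encard_coe_eq_coe_finsetCard, Set.encard_coe_eq_coe_finsetCard, Nat.cast_inj] at h1
      convert h1 using 2 <;> (ext; simp)
    have c1 := Finset.card_filter_add_card_filter_not (s := Finset.univ.filter fun v => f v = 2)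
      (fun v => g v = 1)
    have c2 := Finset.card_filter_add_card_filter_not (s := Finset.univ.filter fun v => g v = 2)
      (fun v => f v = 1)
    have c3 : ((Finset.univ.filter fun v => f v = 2).filter fun v => ¬ g v = 1) =
        (Finset.univ.filter fun v => g v = 2).filter fun v => ¬ f v = 1 := by
      ext v
      have := hf v
      have := hg v
      simp
      omega
    have d1 := Finset.card_filter_add_card_filter_not (s := (Finset.univ : Finset V))
      (fun v => f v = 2 ∧ g v = 1)
    have d2 := Finset.card_filter_add_card_filter_not (s := (Finset.univ : Finset V))
      (fun v => g v = 2 ∧ f v = 1)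
    rw [c3] at c1
    rw [Finset.filter_filter] at c1 c2
    rw [Fintype.card_subtype, Fintype.card_subtype]
    simp only [and_comm (a := f _ = 1)]
    omega
  let ι : {v // ¬ (f v = 2 ∧ g v = 1)} → {v // ¬ (f v = 1 ∧ g v = 2)} := fun v => ⟨τ v, hA v⟩
  have hι : Function.Bijective ι := by
    rw [Fintype.bijective_iff_injective_and_card]
    refine ⟨fun v w hvw => Subtype.ext (hinj v w v.2 w.2 (congrArg Subtype.val hvw)), hcard⟩
  -- The extension maps complement to complement, that is, type (2,1) to type (1,2): these are the
  -- artificial arcs.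
  refine ⟨(Equiv.ofBijective ι hι).extendSubtype, fun v => ?_⟩
  by_cases hv : f v = 2 ∧ g v = 1
  · have := (Equiv.ofBijective ι hι).extendSubtype_not_mem v (not_not.2 hv)
    exact .inl ⟨hv.1, hv.2, not_not.1 this⟩
  · right
    rw [Equiv.extendSubtype_apply_of_mem _ v hv]
    refine ⟨hv, hA v, ?_⟩
    change τ v = v ∧ _ ∨ G.Adj v (τ v) ∧ _
    rcases hτ v with h1 | ⟨_, h1⟩ | ⟨_, _, h1⟩
    · have := h1.2
      exact .inr ⟨S₁.subset_edgeSet h1.1, by change ¬ (_ ∧ f (τ v) = g (τ v) ∧ f v = f (τ v)); omega⟩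
    · have := h1.2
      exact .inr ⟨S₂.subset_edgeSet h1.1, by change ¬ (_ ∧ f (τ v) = g (τ v) ∧ f v = f (τ v)); omega⟩
    · have h2 := hA v
      rw [h1] at h2
      have := hf v
      have := hg v
      exact .inl ⟨h1, by omega⟩

theorem rt_le_two_iff_exists_isRouting {V : Type*} [Finite V] {G : SimpleGraph V} {f g : V → ℕ}
    (hf : IsColoring 2 f) (hg : IsColoring 2 g) (hfg : Consistent f g) :
    rt G f g ≤ 2 ↔ ∃ σ : Equiv.Perm V, IsRouting G f g σ := by
  rw [rt_le_two_iff]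
  exact ⟨fun ⟨_, _, h⟩ => exists_isRouting hf hg hfg h, fun ⟨_, h⟩ => h.exists_swaps hf hg⟩

/-! ### From encoded instances to the auction -/

namespace TwoColorInstance

variable (I : TwoColorInstance)

/-- The bit of a vertex for a coloring. -/
def bit {n : ℕ} (f : Fin n → ℕ) (u : ℕ) : Bool := if h : u < n then f ⟨u, h⟩ = 2 else false

open Classical in
/-- The adjacency matrix, indexed by natural numbers. -/
noncomputable def adjBit (u v : ℕ) : Bool :=
  if h : u < I.n ∧ v < I.n then I.graph.Adj ⟨u, h.1⟩ ⟨v, h.2⟩ else false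

/-- The letter on the tape of the auction machine for a letter of the input. -/
def inputLetter : Option Bool → Letter Header Cell
  | some b => .inl b
  | none => .inr (.inr (AuctionState.initialHeader, ⟨false, false, false⟩))

theorem map_encode : I.encode.map inputLetter =
    rawRowsWord (bit I.f) (bit I.g) (fun r => (List.range I.n).map (I.adjBit r))
      AuctionState.initialHeader ⟨false, false, false⟩ I.n := by
  simp only [encode, rawRowsWord, ← List.map_coe_finRange_eq_range, List.flatMap_map,
    List.map_flatMap]
  refine List.flatMap_congr fun u _ => ?_
  simp [encodeVertex, rawRowWord, inputLetter, bit, adjBit, Function.comp_def,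
    -List.map_coe_finRange_eq_range]

variable {I} in
theorem admissible_iff_routing {f g : Fin I.n → ℕ} (hf : IsColoring 2 f) (hg : IsColoring 2 g)
    (v w : Fin I.n) :
    AuctionState.Adm (bit f) (bit g) I.adjBit v w ↔
    ((f v = 2 ∧ g v = 1 ∧ f w = 1 ∧ g w = 2) ∨
    (¬ (f v = 2 ∧ g v = 1) ∧ ¬ (f w = 1 ∧ g w = 2) ∧ (w = v ∧ f v = g v ∨
      I.graph.Adj v w ∧ ¬ (f v = g v ∧ f w = g w ∧ f v = f w)))) := by
  have hv : (v : ℕ) = w ↔ w = v := by rw [Fin.val_inj, eq_comm]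
  have e : ∀ {k : Fin I.n → ℕ} (hk : IsColoring 2 k) (u : Fin I.n),
      (k u = 1 ∧ bit k u = false) ∨ (k u = 2 ∧ bit k u = true) := by
    intro k hk u
    have := hk u
    rcases (by omega : k u = 1 ∨ k u = 2) with h | h <;> simp [bit, h]
  simp only [AuctionState.Adm, hv, adjBit, v.2, w.2, and_self, dite_true, Fin.eta]
  rcases e hf v with ⟨h1, k1⟩ | ⟨h1, k1⟩ <;> rcases e hg v with ⟨h2, k2⟩ | ⟨h2, k2⟩ <;>
    rcases e hf w with ⟨h3, k3⟩ | ⟨h3, k3⟩ <;> rcases e hg w with ⟨h4, k4⟩ | ⟨h4, k4⟩ <;>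
    simp [admissible, h1, h2, h3, h4, k1, k2, k3, k4]

theorem hasMatching_iff :
    AuctionState.HasMatching I.n (bit I.f) (bit I.g) I.adjBit ↔ rt I.graph I.f I.g ≤ 2 := by
  rw [rt_le_two_iff_exists_isRouting I.isColoring_f I.isColoring_g I.consistent]
  constructor
  · rintro ⟨σ, h1, h2⟩
    let τ : Fin I.n → Fin I.n := fun v => ⟨σ v, (h1 v v.2).1⟩
    have hτ : Function.Injective τ := fun v w h =>
      Fin.ext (h2 v v.2 w w.2 (congrArg Fin.val h))
    refine ⟨Equiv.ofBijective τ (Finite.injective_iff_bijective.1 hτ), fun v => ?_⟩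
    exact (admissible_iff_routing I.isColoring_f I.isColoring_g v (τ v)).1 (h1 v v.2).2
  · rintro ⟨σ, h⟩
    refine ⟨fun r => if hr : r < I.n then σ ⟨r, hr⟩ else 0, fun r hr => ?_, fun r hr s hs => ?_⟩
    · simp only [hr, dite_true, Fin.is_lt, true_and]
      exact (admissible_iff_routing I.isColoring_f I.isColoring_g ⟨r, hr⟩ (σ ⟨r, hr⟩)).2 (h ⟨r, hr⟩)
    · simp [hr, hs, Fin.val_inj]

end TwoColorInstance

theorem polyTimeDecidable_rt_le_two :
    PolyTimeDecidable TwoColorInstance.encode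
      (fun I : TwoColorInstance => rt I.graph I.f I.g ≤ 2) := by
  have : Nonempty (Letter Header Cell) := ⟨.inl true⟩
  refine auction.toSweep.polyTimeDecidable TwoColorInstance.inputLetter auction.sweepStart _ _
    -- This is `potentialBound n + 1` with the input length `n * (n + 3)`, which is at least `n`, in
    -- place of `n`.
    (.X * .X * ((.X + 1) * .X) + .X * .X + .X + 1) fun I => ?_
  obtain ⟨k, hk, hd⟩ := AuctionState.decides_rawRowsWord (n := I.n)
    (f := TwoColorInstance.bit I.f) (g := TwoColorInstance.bit I.g) (adj := I.adjBit)
    ⟨false, false, false⟩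
  rw [← I.map_encode] at hd
  simp only [I.hasMatching_iff] at hd
  refine ⟨k, hk.trans ?_, by convert hd⟩
  have hn : I.n ≤ I.encode.length := by
    rw [I.length_encode]
    nlinarith
  simp only [AuctionState.potentialBound, Polynomial.eval_add, Polynomial.eval_mul,
    Polynomial.eval_X, Polynomial.eval_one]
  gcongr

end ColoredRouting

theorem mainTheorem7 :
    ColoredRouting.PolyTimeDecidable ColoredRouting.TwoColorInstance.encode
      (fun I : ColoredRouting.TwoColorInstance => ColoredRouting.rt I.graph I.f I.g ≤ 2) :=
  ColoredRouting.polyTimeDecidable_rt_le_two
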